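/- Let $d\ge 1$, let $P$ be the law of a pair $(X,Y)\in\mathbb R^d\times\mathbb R$ with $Y$ integrable, let $P^X$ be the law of $X$, and let $S_X\subset\mathbb R^d$ be a set with $X\in S_X$ almost surely. Let $\|\cdot\|$ be the Euclidean norm and $B(x,\tau)$ the closed ball of centre $x$ and radius $\tau$. Assume: (E) with $g(x)=\mathbb E[Y\mid X=x]$ and $\varepsilon=Y-g(X)$, one has $\mathbb E[\varepsilon\mid X]=0$ and $\mathbb E[e^{t\varepsilon}\mid X]\le e^{t^2\sigma^2/2}$ almost surely, for every $t\in\mathbb R$ (with $e^{t\varepsilon}$ integrable); (D) the sample $(X_1,Y_1),\dots,(X_n,Y_n)$ is independent with common law $P$; (L) $g$ is $L$-Lipschitz on $S_X$; (XNN) there are a function $\ell>0$ on $S_X$ and $T_0>0$ such that $P^X(B(x,\tau))\ge \ell(x)\tau^d$ for all $x\in S_X$ and $\tau\in(0,T_0)$. For an integer $k$, let $\hat\tau_{n,k}(x)=\inf\{\tau>0:\sum_{i=1}^n\mathbf 1_{B(x,\tau)}(X_i)\ge k\}$, let $\mathcal V(x)=B(x,\hat\tau_{n,k}(x))$, and let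 $$\hat g_{\mathcal V}(x)=\frac{\sum_{i=1}^n Y_i\mathbf 1_{\mathcal V(x)}(X_i)}{\sum_{i=1}^n \mathbf 1_{\mathcal V(x)}(X_i)}\qquad(0/0=0)$$ be the $k$-nearest-neighbour estimator. Let $L(\mathcal V(x))$ be the smallest $M\ge0$ with $|g(y)-g(z)|\le M\|y-z\|$ for all $y,z\in\mathcal V(x)\cap S_X$. Fix $\delta\in(0,1/3)$. An assertion holds with probability at least $p$ if it holds on a measurable event of probability at least $p$. 1. For all $n\ge1$ and all integers $k\ge 8\log\big(4(2n+1)^{d+1}/\delta\big)$, with probability at least $1-3\delta$, for all $x\in S_X$ with $2k\le T_0^d\,n\,\ell(x)$, $$|\hat g_{\mathcal V}(x)-g(x)|\le\sqrt{\frac{2\sigma^2\log\big((n+1)^{d+1}/\delta\big)}{k}}+2\Big(\frac{2k}{n\,\ell(x)}\Big)^{1/d}L(\mathcal V(x)).$$ 2. Let $0<a_1\le1\le a_2$, and consider integers $n,k$ with $$a_1k\le n^{2/(d+2)}\log\big((n+1)^{d+1}/\delta\big)^{d/(d+2)}\le a_2k.\qquad(*)$$ There is $N:\mathbb R^d\to\mathbb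 N$ (depending on neither $n$, $k$ nor the sample) such that, for all $n,k$ satisfying $(*)$, with probability at least $1-3\delta$, for all $x\in S_X$ with $n\ge N(x)$, $$|\hat g_{\mathcal V}(x)-g(x)|\le\frac{\sqrt{a_2}}{a_1}\Big(\sqrt{2\sigma^2}+2L(\mathcal V(x))\Big(\frac2{\ell(x)}\Big)^{1/d}\Big)\Big(\frac{\log((n+1)^{d+1}/\delta)}{n}\Big)^{1/(d+2)}.$$ 3. If moreover $\ell(x)\ge b>0$ for all $x\in S_X$, then for all $0<a_1\le1\le a_2$ there is $N\in\mathbb N$ such that, for all $n\ge N$ and all $k$ satisfying $(*)$, with probability at least $1-3\delta$, $$\sup_{x\in S_X}|\hat g_{\mathcal V}(x)-g(x)|\le\frac{\sqrt{a_2}}{a_1}\Big(\sqrt{2\sigma^2}+2L\Big(\frac2b\Big)^{1/d}\Big)\Big(\frac{\log((n+1)^{d+1}/\delta)}{n}\Big)^{1/(d+2)}.$$ -/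

import Mathlib

open MeasureTheory ProbabilityTheory

universe u

/-- The covariate space `ℝ^d` with its Euclidean norm. -/
abbrev Cov (d : ℕ) : Type := EuclideanSpace ℝ (Fin d)

section Population

variable {d : ℕ}

/-- The sigma-algebra generated by the covariate `X`, where `(X, Y)` is the identity of
`ℝ^d × ℝ` under the joint law `P`. -/
abbrev sigmaX (d : ℕ) : MeasurableSpace (Cov d × ℝ) :=
  MeasurableSpace.comap Prod.fst inferInstance

/-- `g` is a version of the regression function: `g(X) = E[Y | X]` almost surely. -/
structure IsRegressionFunction (P : Measure (Cov d × ℝ)) (g : Cov d → ℝ) : Prop where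
  integrable : Integrable (fun p => p.2) P
  condExp_eq : P[fun p => p.2 | sigmaX d] =ᵐ[P] fun p => g p.1

/-- The noise `ε = Y - g(X)` is sub-Gaussian conditionally on `X` with parameter `σ²`.
Integrability is part of the definition, so that no conditional expectation is a default value. -/
structure CondSubGaussianNoise (P : Measure (Cov d × ℝ)) (g : Cov d → ℝ) (σ : ℝ) : Prop where
  integrable : Integrable (fun p => p.2 - g p.1) P
  condExp_zero : P[fun p => p.2 - g p.1 | sigmaX d] =ᵐ[P] 0
  integrable_exp : ∀ t : ℝ, Integrable (fun p => Real.exp (t * (p.2 - g p.1))) P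
  condExp_exp_le : ∀ t : ℝ,
    P[fun p => Real.exp (t * (p.2 - g p.1)) | sigmaX d]
      ≤ᵐ[P] fun _ => Real.exp (t ^ 2 * σ ^ 2 / 2)

/-- The ball-mass condition: `ℓ > 0` on `S`, `T₀ > 0` and `P^X(B(x, τ)) ≥ ℓ(x) τ^d` for all
`x ∈ S` and `τ ∈ (0, T₀)`, where `P^X` is the law of the covariate. -/
structure BallMass (P : Measure (Cov d × ℝ)) (S : Set (Cov d)) (ℓ : Cov d → ℝ) (T₀ : ℝ) :
    Prop where
  radius_pos : 0 < T₀
  pos : ∀ x ∈ S, 0 < ℓ x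
  mass : ∀ x ∈ S, ∀ τ : ℝ, 0 < τ → τ < T₀ → ℓ x * τ ^ d ≤ P.fst.real (Metric.closedBall x τ)

/-- The local Lipschitz constant of `g` over `V`: the smallest `M` with
`|g x - g y| ≤ M ‖x - y‖` for all `x, y ∈ V`. -/
noncomputable def localLip (g : Cov d → ℝ) (V : Set (Cov d)) : ℝ :=
  sInf {M : ℝ | 0 ≤ M ∧ ∀ x ∈ V, ∀ y ∈ V, |g x - g y| ≤ M * ‖x - y‖}

/-- The uniform distance `sup_{x ∈ S} |f x - g x|`, with values in `[0, ∞]`. -/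
noncomputable def supDist (S : Set (Cov d)) (f g : Cov d → ℝ) : ENNReal :=
  ⨆ x ∈ S, ENNReal.ofReal |f x - g x|

end Population

section Estimator

variable {d n : ℕ}

/-- The number of sample covariates in `V`. -/
noncomputable def countIn (D : Fin n → Cov d × ℝ) (V : Set (Cov d)) : ℝ :=
  ∑ i, V.indicator (fun _ => (1 : ℝ)) (D i).1

/-- The estimator attached to a local map `V`: the average of the responses over the sample
points whose covariates lie in `V x` (and `0` if there are none). -/
noncomputable def localEstimator (V : Cov d → Set (Cov d)) (D : Fin n → Cov d × ℝ)
    (x : Cov d) : ℝ :=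
  (∑ i, (V x).indicator (fun _ => (D i).2) (D i).1) / countIn D (V x)

/-- The `k`-nearest-neighbour radius at `x`: the smallest radius of a closed ball around `x`
that holds at least `k` sample covariates. -/
noncomputable def knnRadius (k : ℕ) (D : Fin n → Cov d × ℝ) (x : Cov d) : ℝ :=
  sInf {τ : ℝ | 0 < τ ∧ (k : ℝ) ≤ countIn D (Metric.closedBall x τ)}

/-- The nearest-neighbour local map. -/
noncomputable def knnMap (k : ℕ) (D : Fin n → Cov d × ℝ) (x : Cov d) : Set (Cov d) :=
  Metric.closedBall x (knnRadius k D x)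

/-- The `k`-nearest-neighbour regression estimator. -/
noncomputable def knnEstimator (k : ℕ) (D : Fin n → Cov d × ℝ) : Cov d → ℝ :=
  localEstimator (knnMap k D) D

end Estimator

section Sampling

variable {Ω : Type u} [MeasurableSpace Ω]

/-- `D 0, …, D (n - 1)` are independent random pairs with common law `P`. -/
structure IsIIDSample {d n : ℕ} (μ : Measure Ω) (P : Measure (Cov d × ℝ))
    (D : Fin n → Ω → Cov d × ℝ) : Prop where
  measurable : ∀ i, Measurable (D i)
  indep : iIndepFun D μ
  law : ∀ i, μ.map (D i) = P

/-- The property `Q` holds with probability at least `p`: it holds on a measurable event of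
probability at least `p`. -/
def HoldsWithProb (μ : Measure Ω) (p : ℝ) (Q : Ω → Prop) : Prop :=
  ∃ A : Set Ω, MeasurableSet A ∧ p ≤ μ.real A ∧ ∀ ω ∈ A, Q ω

end Sampling

/-- The logarithmic factor `log ((n + 1)^(d + 1) / δ)`. -/
noncomputable def logTerm (d n : ℕ) (δ : ℝ) : ℝ :=
  Real.log (((n : ℝ) + 1) ^ (d + 1) / δ)

/-- `k ≍ n^(2/(d+2)) log((n+1)^(d+1)/δ)^(d/(d+2))` with comparison constants `a₁` and `a₂`. -/
def IsOptimalOrder (d n k : ℕ) (δ a₁ a₂ : ℝ) : Prop :=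
  a₁ * k ≤ (n : ℝ) ^ (2 / ((d : ℝ) + 2)) * logTerm d n δ ^ ((d : ℝ) / ((d : ℝ) + 2)) ∧
  (n : ℝ) ^ (2 / ((d : ℝ) + 2)) * logTerm d n δ ^ ((d : ℝ) / ((d : ℝ) + 2)) ≤ a₂ * k

/-! On a good sample the bound is a bias–variance split. Take `τ` with `n ℓ(x) τ^d = 2k`, so that
`B(x, τ)` has mass at least `2k/n`. If every ball of that mass holds `k` covariates, the
nearest-neighbour radius is at most `τ`, and the bias is at most `τ` times the local Lipschitz
constant. If the noise summed over the `m` sample points of any ball is at most `√(2σ² t m)`, with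
`t = logTerm d n δ`, then its average is at most `√(2σ² t / k)`, because `m ≥ k`.

Both uniform statements rest on the fact that closed balls leave at most `(m + 1)^(d + 1)` traces on
`m` points (Radon and Sauer–Shelah: `card_traces_closedBall_le`). The mass statement is a relative
Vapnik–Chervonenkis inequality, proved with a ghost sample and random swaps
(`measure_underfilled_le`). The noise statement is a Chernoff bound conditional on the covariates,
summed over the traces that occur (`CondSubG.measure_noisy_le`). Their failures cost `δ` and `2δ`.

For the rates put `ρ = (t/n)^(1/(d+2))`. The prescribed order of `k` is `n ρ^d`, and then `√(t/k)`
and `(k/n)^(1/d)` are both of order `ρ`. -/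

/-! ### Traces of balls on finite sets and their Vapnik–Chervonenkis dimension -/

section Traces

variable {E κ ι : Type*} [Fintype κ]

open Classical in
/-- The indices of the points of `z` that lie in `B`. -/
noncomputable def hits (B : Set E) (z : κ → E) : Finset κ :=
  Finset.univ.filter fun j => z j ∈ B

@[simp]
lemma mem_hits {B : Set E} {z : κ → E} {j : κ} : j ∈ hits B z ↔ z j ∈ B := by
  simp [hits]

open Classical in
/-- The traces that the sets `B i` leave on the points of `z`. -/
noncomputable def traces (B : ι → Set E) (z : κ → E) : Finset (Finset κ) :=
  Finset.univ.filter fun T => ∃ i, hits (B i) z = T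

@[simp]
lemma mem_traces {B : ι → Set E} {z : κ → E} {T : Finset κ} :
    T ∈ traces B z ↔ ∃ i, hits (B i) z = T := by
  simp [traces]

lemma countIn_eq_card_hits {d n : ℕ} (D : Fin n → Cov d × ℝ) (V : Set (Cov d)) :
    countIn D V = ((hits V fun i => (D i).1).card : ℝ) := by
  classical
  simp only [countIn, hits, Finset.card_filter, Set.indicator_apply]
  push_cast
  rfl

/-- Term by term against the binomial expansion of `(m + 1) ^ v`, since `m.choose k ≤ m ^ k`. -/
lemma sum_choose_le_pow (m v : ℕ) : ∑ k ∈ Finset.Iic v, m.choose k ≤ (m + 1) ^ v := by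
  rw [add_pow, ← Nat.range_succ_eq_Iic]
  refine Finset.sum_le_sum fun k hk => ?_
  have hk' : k ≤ v := Nat.lt_succ_iff.1 (Finset.mem_range.1 hk)
  calc m.choose k ≤ m ^ k := Nat.choose_le_pow m k
    _ ≤ m ^ k * 1 ^ (v - k) * v.choose k := by
      rw [one_pow, mul_one]
      exact Nat.le_mul_of_pos_right _ (Nat.choose_pos hk')

/-- Sauer–Shelah, with the polynomial bound. -/
lemma card_le_of_forall_shatters [DecidableEq κ] (𝒜 : Finset (Finset κ)) (v : ℕ)
    (h : ∀ T, 𝒜.Shatters T → T.card ≤ v) : 𝒜.card ≤ (Fintype.card κ + 1) ^ v := by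
  calc 𝒜.card ≤ 𝒜.shatterer.card := 𝒜.card_le_card_shatterer
    _ ≤ _ := Finset.card_shatterer_le_sum_vcDim
    _ ≤ _ := sum_choose_le_pow _ _
    _ ≤ _ := Nat.pow_le_pow_right (Nat.succ_pos _)
      (Finset.sup_le fun T hT => h T (Finset.mem_shatterer.1 hT))

/-- Two balls of a Euclidean space cannot cut out complementary parts of a Radon partition. -/
lemma affineIndependent_of_ball_partitions {α F : Type*} [NormedAddCommGroup F]
    [InnerProductSpace ℝ F] {f : α → F}
    (h : ∀ I : Set α, ∃ c : F, ∃ r : ℝ, 0 ≤ r ∧ ∀ j, f j ∈ Metric.closedBall c r ↔ j ∈ I) :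
    AffineIndependent ℝ f := by
  by_contra hf
  obtain ⟨I, p, hp, hp'⟩ := Convex.radon_partition hf
  obtain ⟨c₁, r₁, hr₁, h₁⟩ := h I
  obtain ⟨c₂, r₂, hr₂, h₂⟩ := h Iᶜ
  -- The term `‖z‖ ^ 2` is common to all balls, so subtracting the inequalities of two balls leaves
  -- an affine condition. The two parts then lie strictly on opposite sides of the hyperplane at
  -- level `K`, and so do their hulls, which share `p`.
  have key : ∀ (c : F) (r : ℝ), 0 ≤ r → ∀ z : F, z ∈ Metric.closedBall c r ↔
      ‖z‖ ^ 2 - 2 * inner ℝ c z + ‖c‖ ^ 2 ≤ r ^ 2 := by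
    intro c r hr z
    rw [mem_closedBall_iff_norm, ← sq_le_sq₀ (norm_nonneg _) hr, norm_sub_sq_real,
      real_inner_comm]
  have hlin : IsLinearMap ℝ fun z : F => inner ℝ (c₂ - c₁) z :=
    ((innerSL ℝ (c₂ - c₁)) : F →ₗ[ℝ] ℝ).isLinear
  set K : ℝ := (‖c₂‖ ^ 2 - r₂ ^ 2 - ‖c₁‖ ^ 2 + r₁ ^ 2) / 2
  have hlt : inner ℝ (c₂ - c₁) p < K := by
    refine convexHull_min (s := f '' I) ?_ (convex_halfSpace_lt hlin K) hp
    rintro _ ⟨j, hj, rfl⟩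
    have a := (key c₁ r₁ hr₁ _).1 ((h₁ j).2 hj)
    have b := (key c₂ r₂ hr₂ (f j)).not.1 ((h₂ j).not.2 (by simpa using hj))
    simp only [Set.mem_ofPred_eq, inner_sub_left, K]
    linarith
  have hgt : K < inner ℝ (c₂ - c₁) p := by
    refine convexHull_min (s := f '' Iᶜ) ?_ (convex_halfSpace_gt hlin K) hp'
    rintro _ ⟨j, hj, rfl⟩
    have a := (key c₂ r₂ hr₂ _).1 ((h₂ j).2 hj)
    have b := (key c₁ r₁ hr₁ (f j)).not.1 ((h₁ j).not.2 hj)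
    simp only [Set.mem_ofPred_eq, inner_sub_left, K]
    linarith
  exact lt_asymm hlt hgt

/-- Closed balls of `ℝ^d` leave at most `(m + 1)^(d + 1)` traces on `m` points. -/
lemma card_traces_closedBall_le {d : ℕ} (c : ι → Cov d) (r : ι → ℝ) (hr : ∀ i, 0 ≤ r i)
    (z : κ → Cov d) :
    (traces (fun i => Metric.closedBall (c i) (r i)) z).card
      ≤ (Fintype.card κ + 1) ^ (d + 1) := by
  classical
  refine card_le_of_forall_shatters _ _ fun T hT => ?_
  have hind : AffineIndependent ℝ fun j : T => z j := by
    refine affineIndependent_of_ball_partitions fun I => ?_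
    obtain ⟨U, hU, hTU⟩ := hT (t := T.filter fun j => ∃ h : j ∈ T, (⟨j, h⟩ : T) ∈ I)
      (Finset.filter_subset _ _)
    obtain ⟨i, rfl⟩ := mem_traces.1 hU
    refine ⟨c i, r i, hr i, fun j => ?_⟩
    have := congrArg (fun s => (j : κ) ∈ s) hTU
    simpa using this
  have h1 := hind.card_le_finrank_succ
  have h2 := Submodule.finrank_le (vectorSpan ℝ (Set.range fun j : T => z j))
  simp only [Fintype.card_coe, finrank_euclideanSpace, Fintype.card_fin] at h1 h2
  omega

end Traces

/-! ### Reduction to countably many balls -/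

section RationalBalls

variable {d : ℕ}

/-- The closed balls with centre in a countable dense set and rational radius. -/
noncomputable def rationalBall (d : ℕ) (i : ℕ × NNRat) : Set (Cov d) :=
  Metric.closedBall (TopologicalSpace.denseSeq (Cov d) i.1) ((i.2 : ℝ))

lemma card_traces_rationalBall_le {κ : Type*} [Fintype κ] (z : κ → Cov d) :
    (traces (rationalBall d) z).card ≤ (Fintype.card κ + 1) ^ (d + 1) :=
  card_traces_closedBall_le _ _ (fun _ => NNRat.cast_nonneg _) z

lemma measurableSet_rationalBall (i : ℕ × NNRat) : MeasurableSet (rationalBall d i) :=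
  Metric.isClosed_closedBall.measurableSet

/-- The finitely many points outside a closed ball stay at positive distance from it. This serves
both to pass to rational balls and to show that the nearest-neighbour radius is attained. -/
lemma exists_hits_closedBall_eq {X κ : Type*} [PseudoMetricSpace X] [Fintype κ] (z : κ → X)
    (x : X) (τ : ℝ) :
    ∃ η > 0, ∀ j, z j ∈ Metric.closedBall x (τ + η) → z j ∈ Metric.closedBall x τ := by
  have : ∀ᶠ η in nhdsWithin (0 : ℝ) (Set.Ioi 0),
      ∀ j, z j ∈ Metric.closedBall x (τ + η) → z j ∈ Metric.closedBall x τ := by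
    refine Filter.eventually_all.2 fun j => ?_
    by_cases hj : z j ∈ Metric.closedBall x τ
    · exact Filter.Eventually.of_forall fun _ _ => hj
    · have h0 : 0 < dist (z j) x - τ := by
        rw [Metric.mem_closedBall] at hj
        linarith
      filter_upwards [Ioo_mem_nhdsGT h0] with η hη hz
      rw [Metric.mem_closedBall] at hz
      linarith [hη.2]
  obtain ⟨η, hη, h⟩ := (this.and self_mem_nhdsWithin).exists
  exact ⟨η, h, hη⟩

/-- A closed ball lies in a rational ball with the same trace on finitely many points. -/
lemma exists_rationalBall {κ : Type*} [Fintype κ] (z : κ → Cov d) (x : Cov d) {τ : ℝ}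
    (hτ : 0 ≤ τ) : ∃ i, Metric.closedBall x τ ⊆ rationalBall d i ∧
      hits (rationalBall d i) z = hits (Metric.closedBall x τ) z := by
  obtain ⟨η, hη, h⟩ := exists_hits_closedBall_eq z x τ
  obtain ⟨m, hm⟩ := (TopologicalSpace.denseRange_denseSeq (Cov d)).exists_dist_lt x
    (show 0 < η / 4 by positivity)
  -- The centre moves by less than `η / 4`: a radius above `τ + η / 4` covers the ball, and one
  -- below `τ + η / 2` stays within `B(x, τ + η)`.
  obtain ⟨q, hq1, hq2⟩ := exists_rat_btwn (show τ + η / 4 < τ + η / 2 by linarith)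
  have hq0 : (0 : ℚ) ≤ q := by
    have : (0 : ℝ) ≤ q := by linarith
    exact_mod_cast this
  lift q to NNRat using hq0
  have hcast : ((q : ℚ) : ℝ) = (q : ℝ) := Rat.cast_nnratCast q
  rw [hcast] at hq1 hq2
  have hsub : Metric.closedBall x τ ⊆ rationalBall d (m, q) := by
    refine Metric.closedBall_subset_closedBall' ?_
    simp only
    linarith
  refine ⟨(m, q), hsub, ?_⟩
  ext j
  simp only [mem_hits]
  refine ⟨fun hj => h j (Metric.closedBall_subset_closedBall' ?_ hj), fun hj => hsub hj⟩
  rw [dist_comm]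
  simp only
  linarith

end RationalBalls

/-! ### Measurability of counts -/

section Hits

variable {E κ ι : Type*} [Fintype κ]

open Classical in
lemma card_hits_eq_sum (B : Set E) (z : κ → E) :
    ((hits B z).card : ℝ) = ∑ j, if z j ∈ B then 1 else 0 := by
  simp [hits]

lemma measurableSet_hits_eq [MeasurableSpace E] {B : Set E} (hB : MeasurableSet B)
    (T : Finset κ) : MeasurableSet {z : κ → E | hits B z = T} := by
  have : {z : κ → E | hits B z = T} = ⋂ j, {z : κ → E | z j ∈ B ↔ j ∈ T} := by
    ext z
    simp [Finset.ext_iff]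
  rw [this]
  refine MeasurableSet.iInter fun j => ?_
  have hj : MeasurableSet {z : κ → E | z j ∈ B} := measurable_pi_apply j hB
  by_cases h : j ∈ T
  · simpa [h] using hj
  · simpa [h, Set.compl_def] using hj.compl

lemma measurable_comp_hits [MeasurableSpace E] {B : Set E} (hB : MeasurableSet B)
    (f : Finset κ → ℝ) : Measurable fun z : κ → E => f (hits B z) := by
  let _ : MeasurableSpace (Finset κ) := ⊤
  have h : Measurable fun z : κ → E => hits B z := by
    refine measurable_to_countable' fun T => measurableSet_hits_eq hB T
  exact Measurable.comp (measurable_from_top) h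

end Hits

/-! ### Lower tail of a binomial count -/

section Ghost

variable {E : Type*} [MeasurableSpace E] (ν : Measure E) [IsProbabilityMeasure ν]

lemma integral_card_hits {n : ℕ} {B : Set E} (hB : MeasurableSet B) :
    ∫ x, ((hits B x).card : ℝ) ∂(Measure.pi fun _ : Fin n => ν) = n * ν.real B := by
  classical
  simp_rw [card_hits_eq_sum]
  rw [integral_finsetSum]
  · have h : ∀ j : Fin n, ∫ x : Fin n → E, (if x j ∈ B then (1 : ℝ) else 0)
        ∂(Measure.pi fun _ : Fin n => ν) = ν.real B := by
      intro j
      rw [integral_comp_eval (μ := fun _ : Fin n => ν) (f := fun y => if y ∈ B then (1 : ℝ) else 0)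
        ((Measurable.ite hB measurable_const measurable_const).aestronglyMeasurable)]
      have := integral_indicator_one (μ := ν) hB
      simpa [Set.indicator_apply] using this
    simp [h]
  · intro j _
    refine Integrable.of_bound (C := 1) ?_ ?_
    · exact (Measurable.ite (measurable_pi_apply j hB) measurable_const
        measurable_const).aestronglyMeasurable
    · refine Filter.Eventually.of_forall fun x => ?_
      split_ifs <;> simp

/-- The variance of an indicator is at most its second moment, which equals its mean. -/
lemma variance_card_hits_le {n : ℕ} {B : Set E} (hB : MeasurableSet B) :
    Var[fun x => ((hits B x).card : ℝ); Measure.pi fun _ : Fin n => ν] ≤ n * ν.real B := by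
  classical
  have hm : Measurable fun y : E => if y ∈ B then (1 : ℝ) else 0 :=
    Measurable.ite hB measurable_const measurable_const
  have h := variance_sum_pi (μ := fun _ : Fin n => ν)
    (X := fun _ y => if y ∈ B then (1 : ℝ) else 0) (fun _ => by
      refine MemLp.of_bound hm.aestronglyMeasurable 1 (Filter.Eventually.of_forall fun x => ?_)
      split_ifs <;> simp)
  have h1 : Var[fun y : E => if y ∈ B then (1 : ℝ) else 0; ν] ≤ ν.real B := by
    refine (variance_le_expectation_sq hm.aestronglyMeasurable).trans (le_of_eq ?_)
    have := integral_indicator_one (μ := ν) hB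
    simpa [Set.indicator_apply, Pi.pow_def, ite_pow] using this
  have h2 : (fun x : Fin n → E => ((hits B x).card : ℝ))
      = ∑ j : Fin n, fun x : Fin n → E => if x j ∈ B then (1 : ℝ) else 0 := by
    ext x
    simp [card_hits_eq_sum]
  rw [h2, h, Finset.sum_const, Finset.card_univ, Fintype.card_fin, nsmul_eq_mul]
  gcongr

/-- A binomial variable of mean `m ≥ 74` is at least `0.925 m` with probability at least `1/4`
(Cantelli's inequality). -/
lemma one_fourth_le_measure_card_hits {n : ℕ} {B : Set E} (hB : MeasurableSet B)
    (hm : 74 ≤ n * ν.real B) {c : ℝ} (hc : c ≤ 0.925 * (n * ν.real B)) :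
    1 / 4 ≤ (Measure.pi fun _ : Fin n => ν).real {x | c ≤ ((hits B x).card : ℝ)} := by
  set μ := Measure.pi fun _ : Fin n => ν
  set m : ℝ := n * ν.real B
  -- The shift `40 / 3` is the variance bound `m` divided by the deviation `0.075 m`: this choice
  -- optimises Markov's inequality for the square and gives Cantelli's bound.
  set W : (Fin n → E) → ℝ := fun x => ((hits B x).card : ℝ) - (m + 40 / 3)
  have hmS : Measurable fun x : Fin n → E => ((hits B x).card : ℝ) :=
    measurable_comp_hits hB fun T => (T.card : ℝ)
  have hmW : Measurable W := hmS.sub_const _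
  have hbS : ∀ x : Fin n → E, ‖((hits B x).card : ℝ)‖ ≤ n := by
    intro x
    have h1 := Finset.card_le_univ (hits B x)
    rw [Fintype.card_fin] at h1
    rw [Real.norm_of_nonneg (by positivity)]
    exact_mod_cast h1
  have hLS : MemLp (fun x : Fin n → E => ((hits B x).card : ℝ)) 2 μ :=
    MemLp.of_bound hmS.aestronglyMeasurable n (Filter.Eventually.of_forall hbS)
  have hLW : MemLp W 2 μ := hLS.sub (memLp_const _)
  have hVar : Var[W; μ] ≤ m := by
    rw [variance_sub_const hmS.aestronglyMeasurable]
    exact variance_card_hits_le ν hB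
  have hE : ∫ x, W x ∂μ = -(40 / 3) := by
    rw [integral_sub (hLS.integrable (by norm_num)) (integrable_const _),
      integral_card_hits ν hB]
    simp [m]
  have hEsq : ∫ x, W x ^ 2 ∂μ ≤ m + (40 / 3) ^ 2 := by
    have := variance_eq_sub hLW
    simp only [Pi.pow_apply, hE] at this
    linarith
  have hMk := mul_meas_ge_le_integral_of_nonneg (μ := μ) (f := fun x => W x ^ 2)
    (Filter.Eventually.of_forall fun x => sq_nonneg _) hLW.integrable_sq
    ((0.075 * m + 40 / 3) ^ 2)
  have hset : MeasurableSet {x : Fin n → E | c ≤ ((hits B x).card : ℝ)} :=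
    measurableSet_le measurable_const hmS
  have hsub : {x : Fin n → E | c ≤ ((hits B x).card : ℝ)}ᶜ
      ⊆ {x | (0.075 * m + 40 / 3) ^ 2 ≤ W x ^ 2} := by
    intro x hx
    simp only [Set.mem_compl_iff, Set.mem_ofPred_eq, not_le] at hx ⊢
    refine sq_le_sq' ?_ ?_ |>.trans_eq (neg_sq (W x)) <;> simp only [W] <;> linarith
  have hle := measureReal_mono hsub (measure_ne_top μ _)
  rw [probReal_compl_eq_one_sub hset] at hle
  have hpos : 0 < (0.075 * m + 40 / 3) ^ 2 := by positivity
  have h34 : m + (40 / 3) ^ 2 ≤ 3 / 4 * (0.075 * m + 40 / 3) ^ 2 := by nlinarith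
  by_contra! hcon
  nlinarith [hMk.trans (hEsq.trans h34)]

end Ghost

/-! ### Random swaps of a double sample -/

section Swap

/-- The pair `p`, swapped if `b` is true. -/
def swapIf {E : Type*} (b : Bool) (p : E × E) : E × E := if b then p.swap else p

lemma measurePreserving_swapIf {E : Type*} [MeasurableSpace E] (ν : Measure E)
    [IsProbabilityMeasure ν] (b : Bool) :
    MeasurePreserving (swapIf b) (ν.prod ν) (ν.prod ν) := by
  cases b
  · exact MeasurePreserving.id _
  · exact Measure.measurePreserving_swap

/-- The sum factorises over `j` into terms `2 cosh(0.3 (u - v)) exp(-0.045 (u + v))`. Each is at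
most `2`, by `cosh x ≤ exp(x² / 2)` and `(u - v)² ≤ u + v` for values in `{0, 1}`; here `0.045 =
0.3² / 2`. -/
lemma sum_bool_prod_exp_le {n : ℕ} (u v : Fin n → ℝ) (hu : ∀ j, u j = 0 ∨ u j = 1)
    (hv : ∀ j, v j = 0 ∨ v j = 1) :
    ∑ s : Fin n → Bool, ∏ j, Real.exp
      ((if s j then 0.3 * (u j - v j) else 0.3 * (v j - u j)) - 0.045 * (u j + v j)) ≤ 2 ^ n := by
  rw [← Fintype.prod_sum (f := fun j (b : Bool) => Real.exp
      ((if b then 0.3 * (u j - v j) else 0.3 * (v j - u j)) - 0.045 * (u j + v j)))]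
  have : ∀ j, ∑ b : Bool, Real.exp
      ((if b then 0.3 * (u j - v j) else 0.3 * (v j - u j)) - 0.045 * (u j + v j)) ≤ 2 := by
    intro j
    have h1 := Real.cosh_le_exp_half_sq (0.3 * (u j - v j))
    have h2 : (0.3 * (u j - v j)) ^ 2 / 2 ≤ 0.045 * (u j + v j) := by
      rcases hu j with h | h <;> rcases hv j with h' | h' <;> rw [h, h'] <;> norm_num
    have h3 := h1.trans (Real.exp_le_exp.2 h2)
    rw [Real.cosh_eq] at h3
    simp only [Fintype.sum_bool, if_true, Bool.false_eq_true, if_false, Real.exp_sub]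
    rw [← add_div, div_le_iff₀ (Real.exp_pos _),
      show 0.3 * (v j - u j) = -(0.3 * (u j - v j)) by ring]
    linarith
  calc _ ≤ ∏ _j : Fin n, (2 : ℝ) :=
        Finset.prod_le_prod (fun _ _ => Finset.sum_nonneg fun _ _ => (Real.exp_pos _).le)
          fun j _ => this j
    _ = 2 ^ n := by simp

open Classical in
/-- For a fixed double sample, few ways of swapping the pairs make some `B i` rare among the first
components and frequent among the second ones. -/
lemma card_swaps_le {E ι : Type*} {n : ℕ} (B : ι → Set E) {k : ℝ} {G : ℕ} (z : Fin n → E × E)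
    (hG : (traces B (Sum.elim (fun j => (z j).1) (fun j => (z j).2))).card ≤ G) :
    ((Finset.univ.filter fun s : Fin n → Bool =>
      ∃ i, ((hits (B i) fun j => (swapIf (s j) (z j)).1).card : ℝ) ≤ k ∧
        1.85 * k ≤ ((hits (B i) fun j => (swapIf (s j) (z j)).2).card : ℝ)).card : ℝ)
      ≤ 2 ^ n * (G * Real.exp (-k / 8)) := by
  set w : Fin n ⊕ Fin n → E := Sum.elim (fun j => (z j).1) (fun j => (z j).2)
  set u : Finset (Fin n ⊕ Fin n) → Fin n → ℝ := fun T j => if Sum.inl j ∈ T then 1 else 0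
  set v : Finset (Fin n ⊕ Fin n) → Fin n → ℝ := fun T j => if Sum.inr j ∈ T then 1 else 0
  set ψ : Finset (Fin n ⊕ Fin n) → (Fin n → Bool) → ℝ := fun T s => ∏ j, Real.exp
    ((if s j then 0.3 * (u T j - v T j) else 0.3 * (v T j - u T j)) - 0.045 * (u T j + v T j))
  have hψ : ∀ T s, 0 ≤ ψ T s := fun T s => Finset.prod_nonneg fun _ _ => (Real.exp_pos _).le
  have hk0 : ∀ s : Fin n → Bool,
      (∃ i, ((hits (B i) fun j => (swapIf (s j) (z j)).1).card : ℝ) ≤ k ∧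
        1.85 * k ≤ ((hits (B i) fun j => (swapIf (s j) (z j)).2).card : ℝ)) →
      1 ≤ ∑ T ∈ traces B w, ψ T s * Real.exp (-k / 8) := by
    rintro s ⟨i, h1, h2⟩
    have hk : 0 ≤ k := le_trans (by positivity) h1
    have hT : hits (B i) w ∈ traces B w := mem_traces.2 ⟨i, rfl⟩
    refine le_trans ?_ (Finset.single_le_sum
      (fun T _ => mul_nonneg (hψ T s) (Real.exp_pos _).le) hT)
    simp only [ψ]
    rw [← Real.exp_sum, ← Real.exp_add, Real.one_le_exp_iff]
    rw [card_hits_eq_sum] at h1 h2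
    -- The exponent is `0.3 (second - first) - 0.045 (first + second)` in terms of the two counts.
    -- On a bad swap it is at least `(0.255 * 1.85 - 0.345) k`, which exceeds `k / 8` narrowly.
    have h3 : ∑ j, ((if s j then 0.3 * (u (hits (B i) w) j - v (hits (B i) w) j)
          else 0.3 * (v (hits (B i) w) j - u (hits (B i) w) j))
          - 0.045 * (u (hits (B i) w) j + v (hits (B i) w) j))
        = 0.255 * ∑ j, (if (swapIf (s j) (z j)).2 ∈ B i then (1 : ℝ) else 0)
          - 0.345 * ∑ j, (if (swapIf (s j) (z j)).1 ∈ B i then (1 : ℝ) else 0) := by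
      rw [Finset.mul_sum, Finset.mul_sum, ← Finset.sum_sub_distrib]
      refine Finset.sum_congr rfl fun j _ => ?_
      simp only [u, v, w, mem_hits, Sum.elim_inl, Sum.elim_inr, swapIf]
      cases s j <;> simp <;> split_ifs <;> norm_num
    rw [h3]
    linarith
  calc _ = ∑ s ∈ Finset.univ.filter (fun s : Fin n → Bool =>
      ∃ i, ((hits (B i) fun j => (swapIf (s j) (z j)).1).card : ℝ) ≤ k ∧
        1.85 * k ≤ ((hits (B i) fun j => (swapIf (s j) (z j)).2).card : ℝ)), (1 : ℝ) := by simp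
    _ ≤ ∑ s ∈ Finset.univ.filter (fun s : Fin n → Bool =>
      ∃ i, ((hits (B i) fun j => (swapIf (s j) (z j)).1).card : ℝ) ≤ k ∧
        1.85 * k ≤ ((hits (B i) fun j => (swapIf (s j) (z j)).2).card : ℝ)),
          ∑ T ∈ traces B w, ψ T s * Real.exp (-k / 8) :=
        Finset.sum_le_sum fun s hs => hk0 s (Finset.mem_filter.1 hs).2
    _ ≤ ∑ s, ∑ T ∈ traces B w, ψ T s * Real.exp (-k / 8) :=
        Finset.sum_le_sum_of_subset_of_nonneg (Finset.filter_subset _ _) fun s _ _ =>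
          Finset.sum_nonneg fun T _ => mul_nonneg (hψ T s) (Real.exp_pos _).le
    _ = ∑ T ∈ traces B w, (∑ s, ψ T s) * Real.exp (-k / 8) := by
        rw [Finset.sum_comm]
        simp_rw [Finset.sum_mul]
    _ ≤ ∑ T ∈ traces B w, 2 ^ n * Real.exp (-k / 8) := by
        refine Finset.sum_le_sum fun T _ => mul_le_mul_of_nonneg_right
          (sum_bool_prod_exp_le _ _ (fun j => ?_) fun j => ?_) (Real.exp_pos _).le
        · simp only [u]; split_ifs <;> simp
        · simp only [v]; split_ifs <;> simp
    _ = (traces B w).card * (2 ^ n * Real.exp (-k / 8)) := by simp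
    _ ≤ G * (2 ^ n * Real.exp (-k / 8)) := by gcongr
    _ = _ := by ring

end Swap

/-! ### Symmetrization and the relative deviation inequality -/

section Symmetrization

variable {E ι : Type*} [MeasurableSpace E] [Countable ι] (ν : Measure E)

/-- The double samples for which some `B i` is rare in the first half, frequent in the second. -/
def unbalanced (n : ℕ) (B : ι → Set E) (k : ℝ) : Set (Fin n → E × E) :=
  {z | ∃ i, ((hits (B i) fun j => (z j).1).card : ℝ) ≤ k ∧
    1.85 * k ≤ ((hits (B i) fun j => (z j).2).card : ℝ)}

lemma measurableSet_unbalanced {n : ℕ} {B : ι → Set E} (hB : ∀ i, MeasurableSet (B i)) (k : ℝ) :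
    MeasurableSet (unbalanced n B k) := by
  have : unbalanced n B k = ⋃ i, {z | ((hits (B i) fun j => (z j).1).card : ℝ) ≤ k ∧
      1.85 * k ≤ ((hits (B i) fun j => (z j).2).card : ℝ)} := by
    ext z
    simp [unbalanced]
  rw [this]
  refine MeasurableSet.iUnion fun i => ?_
  have h := measurable_comp_hits (κ := Fin n) (hB i) fun T => (T.card : ℝ)
  have h1 : Measurable fun z : Fin n → E × E => fun j => (z j).1 := by fun_prop
  have h2 : Measurable fun z : Fin n → E × E => fun j => (z j).2 := by fun_prop
  exact (measurableSet_le (h.comp h1) measurable_const).inter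
    (measurableSet_le measurable_const (h.comp h2))

/-- Each swap preserves the law of the double sample, so the probability is the mean over samples of
the proportion of bad swaps, which `card_swaps_le` bounds for every fixed sample. -/
lemma measure_unbalanced_le [IsProbabilityMeasure ν] {n G : ℕ} {B : ι → Set E} (hB : ∀ i, MeasurableSet (B i)) (k : ℝ)
    (hG : ∀ w : Fin n ⊕ Fin n → E, (traces B w).card ≤ G) :
    (Measure.pi fun _ : Fin n => ν.prod ν).real (unbalanced n B k) ≤ G * Real.exp (-k / 8) := by
  classical
  set μ := Measure.pi fun _ : Fin n => ν.prod ν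
  set W := unbalanced n B k
  have hW : MeasurableSet W := measurableSet_unbalanced hB k
  set act : (Fin n → Bool) → (Fin n → E × E) → Fin n → E × E := fun s z j => swapIf (s j) (z j)
  have hact : ∀ s, MeasurePreserving (act s) μ μ := fun s =>
    measurePreserving_pi _ _ fun j => measurePreserving_swapIf ν (s j)
  have hint : ∀ s, Integrable ((act s ⁻¹' W).indicator (1 : (Fin n → E × E) → ℝ)) μ := fun s =>
    (integrable_const (1 : ℝ)).indicator ((hact s).measurable hW)
  have hsum : 2 ^ n * μ.real W
      = ∫ z, ∑ s, (act s ⁻¹' W).indicator (1 : (Fin n → E × E) → ℝ) z ∂μ := by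
    rw [integral_finsetSum _ fun s _ => hint s]
    have : ∀ s, ∫ z, (act s ⁻¹' W).indicator (1 : (Fin n → E × E) → ℝ) z ∂μ = μ.real W := by
      intro s
      rw [integral_indicator_one ((hact s).measurable hW),
        (hact s).measureReal_preimage hW.nullMeasurableSet]
    simp [this]
  have hle : ∀ z, ∑ s, (act s ⁻¹' W).indicator (1 : (Fin n → E × E) → ℝ) z
      ≤ 2 ^ n * (G * Real.exp (-k / 8)) := by
    intro z
    refine le_trans (le_of_eq ?_) (card_swaps_le B z (hG _))
    simp only [Set.indicator_apply, Pi.one_apply, Finset.sum_boole]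
    rfl
  have h := integral_mono (integrable_finsetSum _ fun s _ => hint s) (integrable_const _) hle
  rw [← hsum, integral_const, probReal_univ, one_smul] at h
  exact le_of_mul_le_mul_left h (by positivity)

/-- The samples that leave fewer than `k` points in some `B i` of mass at least `2 k / n`. -/
def underfilled (n : ℕ) (B : ι → Set E) (k : ℝ) : Set (Fin n → E) :=
  {x | ∃ i, 2 * k ≤ n * ν.real (B i) ∧ ((hits (B i) x).card : ℝ) < k}

lemma measurableSet_underfilled {n : ℕ} {B : ι → Set E} (hB : ∀ i, MeasurableSet (B i)) (k : ℝ) :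
    MeasurableSet (underfilled ν n B k) := by
  have : underfilled ν n B k = ⋃ i, {x | 2 * k ≤ n * ν.real (B i) ∧
      ((hits (B i) x).card : ℝ) < k} := by
    ext z
    simp [underfilled]
  rw [this]
  exact MeasurableSet.iUnion fun i => (MeasurableSet.const _).inter
    (measurableSet_lt (measurable_comp_hits (hB i) fun T => (T.card : ℝ)) measurable_const)

/-- A one-sided relative Vapnik–Chervonenkis inequality. -/
lemma measure_underfilled_le [IsProbabilityMeasure ν] {n G : ℕ} {B : ι → Set E} (hB : ∀ i, MeasurableSet (B i)) {k : ℝ}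
    (hk : 37 ≤ k) (hG : ∀ w : Fin n ⊕ Fin n → E, (traces B w).card ≤ G) :
    (Measure.pi fun _ : Fin n => ν).real (underfilled ν n B k)
      ≤ 4 * (G * Real.exp (-k / 8)) := by
  set μ := Measure.pi fun _ : Fin n => ν
  set e := MeasurableEquiv.arrowProdEquivProdArrow E E (Fin n)
  have he : MeasurePreserving e (Measure.pi fun _ : Fin n => ν.prod ν) (μ.prod μ) :=
    measurePreserving_arrowProdEquivProdArrow E E (Fin n) (fun _ => ν) fun _ => ν
  have hW := measurableSet_unbalanced (n := n) hB k
  have hW' : MeasurableSet (e.symm ⁻¹' unbalanced n B k) := e.symm.measurable hW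
  have h1 : (μ.prod μ) (e.symm ⁻¹' unbalanced n B k)
      = (Measure.pi fun _ : Fin n => ν.prod ν) (unbalanced n B k) :=
    (he.symm e).measure_preimage hW.nullMeasurableSet
  -- Given a first sample that underfills `B i`, an independent ghost sample has mean count at least
  -- `2k ≥ 74` there. With probability at least `1/4` its count reaches `0.925 * 2k = 1.85 k`, and
  -- the pair is unbalanced.
  have h2 : ENNReal.ofReal (1 / 4) * μ (underfilled ν n B k)
      ≤ (μ.prod μ) (e.symm ⁻¹' unbalanced n B k) := by
    rw [Measure.prod_apply hW', ← setLIntegral_const]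
    refine (lintegral_mono_ae ?_).trans (setLIntegral_le_lintegral (underfilled ν n B k) _)
    filter_upwards [ae_restrict_mem (measurableSet_underfilled ν hB k)] with x hx
    obtain ⟨i, hi, hxi⟩ := hx
    have h4 := one_fourth_le_measure_card_hits ν (hB i) (n := n) (by linarith)
      (c := 1.85 * k) (by linarith)
    rw [Measure.real, ← ENNReal.ofReal_le_iff_le_toReal (measure_ne_top _ _)] at h4
    exact h4.trans (measure_mono fun x' hx' => ⟨i, hxi.le, hx'⟩)
  rw [h1] at h2
  have h3 := ENNReal.toReal_mono (measure_ne_top _ _) h2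
  rw [ENNReal.toReal_mul, ENNReal.toReal_ofReal (by norm_num)] at h3
  have h5 := measure_unbalanced_le ν hB k hG
  simp only [Measure.real] at h5 ⊢
  linarith

end Symmetrization

/-! ### Conditional Chernoff bound for the noise, uniformly over traces -/

section Noise

variable {E : Type*} [MeasurableSpace E]

/-- The hypothesis is a domination between two measures on `E`: the image of the density `w` and `c`
times the law of the first coordinate. Integrating `F` gives the claim. -/
lemma lintegral_fst_mul_le {P : Measure (E × ℝ)} {w : E × ℝ → ENNReal}
    (hw : Measurable w) {c : ENNReal}
    (hc : ∀ A : Set E, MeasurableSet A →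
      ∫⁻ p in Prod.fst ⁻¹' A, w p ∂P ≤ c * P (Prod.fst ⁻¹' A))
    {F : E → ENNReal} (hF : Measurable F) :
    ∫⁻ p, F p.1 * w p ∂P ≤ c * ∫⁻ p, F p.1 ∂P := by
  have hle : (P.withDensity w).map Prod.fst ≤ c • P.map Prod.fst := by
    refine Measure.le_iff.2 fun A hA => ?_
    rw [Measure.map_apply measurable_fst hA, withDensity_apply _ (measurable_fst hA),
      Measure.smul_apply, Measure.map_apply measurable_fst hA, smul_eq_mul]
    exact hc A hA
  have h := lintegral_mono' hle (le_refl F)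
  rw [lintegral_smul_measure, lintegral_map hF measurable_fst, lintegral_map hF measurable_fst,
    lintegral_withDensity_eq_lintegral_mul₀ hw.aemeasurable
      (g := fun p => F p.1) (hF.comp measurable_fst).aemeasurable] at h
  simpa [mul_comm] using h

/-- Conditionally on the first coordinates, the weights `w` of independent pairs multiply. -/
lemma lintegral_mul_prod_le {n : ℕ} {P : Measure (E × ℝ)} [IsProbabilityMeasure P]
    {w : E × ℝ → ENNReal} (hw : Measurable w) {c : ENNReal}
    (hc : ∀ A : Set E, MeasurableSet A →
      ∫⁻ p in Prod.fst ⁻¹' A, w p ∂P ≤ c * P (Prod.fst ⁻¹' A))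
    {F : (Fin n → E) → ENNReal} (hF : Measurable F) (T : Finset (Fin n)) :
    ∫⁻ z, F (fun j => (z j).1) * ∏ j ∈ T, w (z j) ∂(Measure.pi fun _ : Fin n => P)
      ≤ c ^ T.card * ∫⁻ z, F (fun j => (z j).1) ∂(Measure.pi fun _ : Fin n => P) := by
  classical
  induction T using Finset.induction_on with
  | empty => simp
  | insert i T hi ih =>
    have hmF : Measurable fun z : Fin n → E × ℝ => F fun j => (z j).1 :=
      hF.comp (by fun_prop)
    have hmP : ∀ T : Finset (Fin n), Measurable fun z : Fin n → E × ℝ =>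
        F (fun j => (z j).1) * ∏ j ∈ T, w (z j) := fun T =>
      hmF.mul (Finset.measurable_prod _ fun j _ => hw.comp (measurable_pi_apply j))
    have hstep : ∫⁻ z, F (fun j => (z j).1) * ∏ j ∈ insert i T, w (z j)
          ∂(Measure.pi fun _ : Fin n => P)
        ≤ ∫⁻ z, c * (F (fun j => (z j).1) * ∏ j ∈ T, w (z j))
          ∂(Measure.pi fun _ : Fin n => P) := by
      -- Only coordinate `i` is integrated out: `F` still depends on its first component, while the
      -- weights indexed by `T` are constant in it.
      refine lintegral_le_of_lmarginal_le (μ := fun _ : Fin n => P) {i} (hmP _)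
        ((hmP T).const_mul c) ?_
      intro x
      rw [lmarginal_singleton, lmarginal_singleton]
      have hu : ∀ y : E × ℝ, (fun j => (Function.update x i y j).1)
          = Function.update (fun j => (x j).1) i y.1 := by
        intro y
        ext j
        by_cases h : j = i
        · subst h; simp
        · simp [h]
      have hp : ∀ y : E × ℝ, ∏ j ∈ T, w (Function.update x i y j) = ∏ j ∈ T, w (x j) := by
        intro y
        refine Finset.prod_congr rfl fun j hj => ?_
        rw [Function.update_of_ne (ne_of_mem_of_not_mem hj hi)]
      simp only [Finset.prod_insert hi, hu, hp, Function.update_self]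
      set q := ∏ j ∈ T, w (x j)
      have hmU : Measurable fun y : E => F (Function.update (fun j => (x j).1) i y) * q :=
        (hF.comp (measurable_update _)).mul_const _
      have h := lintegral_fst_mul_le hw hc hmU
      have hmV : Measurable fun y : E × ℝ => F (Function.update (fun j => (x j).1) i y.1) * q :=
        hmU.comp measurable_fst
      rw [lintegral_const_mul _ hmV]
      refine le_trans (le_of_eq (lintegral_congr fun y => ?_)) h
      ring
    refine hstep.trans ?_
    rw [lintegral_const_mul _ (hmP T), Finset.card_insert_of_notMem hi, pow_succ', mul_assoc]
    gcongr

/-- The Chernoff bound for the noise of a fixed set of sample points, conditionally on the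
covariates. -/
lemma measure_le_sum_noise_le {n : ℕ} {P : Measure (E × ℝ)} [IsProbabilityMeasure P]
    {e : E × ℝ → ℝ} (he : Measurable e) {l : ℝ} (hl : 0 ≤ l) {c : ENNReal}
    (hc : ∀ A : Set E, MeasurableSet A →
      ∫⁻ p in Prod.fst ⁻¹' A, ENNReal.ofReal (Real.exp (l * e p)) ∂P ≤ c * P (Prod.fst ⁻¹' A))
    {A : Set (Fin n → E)} (hA : MeasurableSet A) (T : Finset (Fin n)) (u : ℝ) :
    (Measure.pi fun _ : Fin n => P) {z | (fun j => (z j).1) ∈ A ∧ u ≤ ∑ j ∈ T, e (z j)}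
      ≤ ENNReal.ofReal (Real.exp (-(l * u))) * c ^ T.card
        * (Measure.pi fun _ : Fin n => P) {z | (fun j => (z j).1) ∈ A} := by
  set μ := Measure.pi fun _ : Fin n => P
  have hm : Measurable fun p => ENNReal.ofReal (Real.exp (l * e p)) := by fun_prop
  have hfst : Measurable fun z : Fin n → E × ℝ => fun j => (z j).1 := by fun_prop
  have hF : Measurable (A.indicator (1 : (Fin n → E) → ENNReal)) :=
    measurable_one.indicator hA
  have hset : MeasurableSet {z : Fin n → E × ℝ |
      (fun j => (z j).1) ∈ A ∧ u ≤ ∑ j ∈ T, e (z j)} :=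
    (hfst hA).inter (measurableSet_le measurable_const
      (Finset.measurable_sum _ fun j _ => he.comp (measurable_pi_apply j)))
  have h1 : ∫⁻ z, A.indicator (1 : (Fin n → E) → ENNReal) (fun j => (z j).1) ∂μ
      = μ {z | (fun j => (z j).1) ∈ A} := by
    have hA' : MeasurableSet {z : Fin n → E × ℝ | (fun j => (z j).1) ∈ A} := hfst hA
    rw [← lintegral_indicator_one hA']
    rfl
  calc _ = ∫⁻ z, {z : Fin n → E × ℝ |
      (fun j => (z j).1) ∈ A ∧ u ≤ ∑ j ∈ T, e (z j)}.indicator 1 z ∂μ :=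
        (lintegral_indicator_one hset).symm
    _ ≤ ∫⁻ z, ENNReal.ofReal (Real.exp (-(l * u)))
        * (A.indicator (1 : (Fin n → E) → ENNReal) (fun j => (z j).1)
        * ∏ j ∈ T, ENNReal.ofReal (Real.exp (l * e (z j)))) ∂μ := by
        refine lintegral_mono fun z => ?_
        refine Set.indicator_apply_le' (fun hz => ?_) fun _ => zero_le
        rw [Set.indicator_of_mem hz.1, Pi.one_apply, Pi.one_apply, one_mul,
          ← ENNReal.ofReal_prod_of_nonneg (fun j _ => (Real.exp_pos _).le), ← Real.exp_sum,
          ← ENNReal.ofReal_mul (Real.exp_pos _).le, ← Real.exp_add, ← Finset.mul_sum]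
        rw [ENNReal.one_le_ofReal, Real.one_le_exp_iff]
        have := mul_le_mul_of_nonneg_left hz.2 hl
        linarith
    _ ≤ ENNReal.ofReal (Real.exp (-(l * u))) * (c ^ T.card *
        ∫⁻ z, A.indicator (1 : (Fin n → E) → ENNReal) (fun j => (z j).1) ∂μ) := by
        rw [lintegral_const_mul' _ _ ENNReal.ofReal_ne_top]
        gcongr
        exact lintegral_mul_prod_le hm hc hF T
    _ = _ := by rw [h1, mul_assoc]

/-- `e` is sub-Gaussian with parameter `σ²` conditionally on the first coordinate. -/
def CondSubG (P : Measure (E × ℝ)) (e : E × ℝ → ℝ) (σ : ℝ) : Prop :=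
  ∀ l : ℝ, ∀ A : Set E, MeasurableSet A →
    ∫⁻ p in Prod.fst ⁻¹' A, ENNReal.ofReal (Real.exp (l * e p)) ∂P
      ≤ ENNReal.ofReal (Real.exp (l ^ 2 * σ ^ 2 / 2)) * P (Prod.fst ⁻¹' A)

lemma CondSubG.neg {P : Measure (E × ℝ)} {e : E × ℝ → ℝ} {σ : ℝ} (h : CondSubG P e σ) :
    CondSubG P (fun p => -e p) σ := by
  intro l A hA
  have := h (-l) A hA
  simpa using this

lemma CondSubG.measure_lt_sum_le {n : ℕ} {P : Measure (E × ℝ)} [IsProbabilityMeasure P]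
    {e : E × ℝ → ℝ} (he : Measurable e) {σ : ℝ} (h : CondSubG P e σ) {t : ℝ} (ht : 0 ≤ t)
    {A : Set (Fin n → E)} (hA : MeasurableSet A) (T : Finset (Fin n)) :
    (Measure.pi fun _ : Fin n => P) {z | (fun j => (z j).1) ∈ A ∧
        Real.sqrt (2 * σ ^ 2 * t * T.card) < ∑ j ∈ T, e (z j)}
      ≤ ENNReal.ofReal (Real.exp (-t))
        * (Measure.pi fun _ : Fin n => P) {z | (fun j => (z j).1) ∈ A} := by
  set μ := Measure.pi fun _ : Fin n => P
  -- For `σ = 0` the optimal `l` is infinite: letting `l → ∞` shows that the sum is almost surely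
  -- nonpositive on the event. The strict inequality in the statement is essential here.
  rcases eq_or_ne σ 0 with rfl | hσ
  · have hz : ∀ m : ℕ, μ {z | (fun j => (z j).1) ∈ A ∧ 1 / ((m : ℝ) + 1) ≤ ∑ j ∈ T, e (z j)}
        = 0 := by
      intro m
      have hb : ∀ l : ℕ, μ {z | (fun j => (z j).1) ∈ A ∧
          1 / ((m : ℝ) + 1) ≤ ∑ j ∈ T, e (z j)}
          ≤ ENNReal.ofReal (Real.exp (-(l * (1 / ((m : ℝ) + 1))))) := by
        intro l
        have h1 := measure_le_sum_noise_le he (Nat.cast_nonneg l) (h l) hA T (1 / ((m : ℝ) + 1))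
        simp only [ne_eq, OfNat.ofNat_ne_zero, not_false_eq_true, zero_pow, mul_zero, zero_div,
          Real.exp_zero, ENNReal.ofReal_one, one_pow, mul_one] at h1
        exact h1.trans (mul_le_of_le_one_right (zero_le) prob_le_one)
      refine le_antisymm (ge_of_tendsto' (x := Filter.atTop) ?_ hb) (zero_le)
      have hlim : Filter.Tendsto (fun l : ℕ => Real.exp (-(l * (1 / ((m : ℝ) + 1)))))
          Filter.atTop (nhds 0) :=
        Real.tendsto_exp_neg_atTop_nhds_zero.comp
          (tendsto_natCast_atTop_atTop.atTop_mul_const (by positivity))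
      simpa using ENNReal.tendsto_ofReal hlim
    refine le_trans (le_of_eq (measure_mono_null ?_ (measure_iUnion_null hz))) (zero_le)
    rintro z ⟨hzA, hz⟩
    have hz' : 0 < ∑ j ∈ T, e (z j) := by simpa using hz
    obtain ⟨m, hm⟩ := exists_nat_one_div_lt hz'
    exact Set.mem_iUnion.2 ⟨m, hzA, hm.le⟩
  rcases T.eq_empty_or_nonempty with rfl | hT
  · simp
  have hcard : 0 < (T.card : ℝ) := by exact_mod_cast hT.card_pos
  have hσ2 : 0 < σ ^ 2 := by positivity
  set u := Real.sqrt (2 * σ ^ 2 * t * T.card)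
  have hu : u ^ 2 = 2 * σ ^ 2 * t * T.card := Real.sq_sqrt (by positivity)
  have hu0 : 0 ≤ u := Real.sqrt_nonneg _
  -- This `l` minimises `-l u + l² σ² |T| / 2`; the minimum `-u² / (2 σ² |T|)` equals `-t`.
  have h1 := measure_le_sum_noise_le he (l := u / (σ ^ 2 * T.card)) (by positivity) (h _) hA T u
  refine (measure_mono fun z (hz : _ ∧ _) => (⟨hz.1, hz.2.le⟩ :
    (fun j => (z j).1) ∈ A ∧ u ≤ ∑ j ∈ T, e (z j))).trans (h1.trans (le_of_eq ?_))
  rw [← ENNReal.ofReal_pow (Real.exp_pos _).le, ← Real.exp_nat_mul,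
    ← ENNReal.ofReal_mul (Real.exp_pos _).le, ← Real.exp_add]
  congr 3
  have : u * u = 2 * σ ^ 2 * t * T.card := by rw [← hu]; ring
  field_simp
  rw [hu]
  ring

variable {ι : Type*}

/-- The samples whose noise is too large over the points in some `B i`. -/
def noisy (n : ℕ) (B : ι → Set E) (e : E × ℝ → ℝ) (σ t : ℝ) : Set (Fin n → E × ℝ) :=
  {z | ∃ i, Real.sqrt (2 * σ ^ 2 * t * (hits (B i) fun j => (z j).1).card)
    < |∑ j ∈ hits (B i) fun j => (z j).1, e (z j)|}

lemma measurableSet_mem_traces [Countable ι] {n : ℕ} {B : ι → Set E} (hB : ∀ i, MeasurableSet (B i))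
    (T : Finset (Fin n)) : MeasurableSet {x : Fin n → E | T ∈ traces B x} := by
  have : {x : Fin n → E | T ∈ traces B x} = ⋃ i, {x | hits (B i) x = T} := by
    ext x
    simp
  rw [this]
  exact MeasurableSet.iUnion fun i => measurableSet_hits_eq (hB i) T

/-- Only the trace matters, so the event is a finite union over index sets `T`, each with its noise
sum over a fixed set. -/
lemma noisy_eq {X : Type*} {n : ℕ} (B : ι → Set X) (e : X × ℝ → ℝ) (σ t : ℝ) :
    noisy n B e σ t = ⋃ T, {z | (fun j => (z j).1) ∈ {x : Fin n → X | T ∈ traces B x} ∧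
        Real.sqrt (2 * σ ^ 2 * t * T.card) < |∑ j ∈ T, e (z j)|} := by
  ext z
  simp only [noisy, mem_traces, Set.mem_iUnion, Set.mem_ofPred_eq]
  constructor
  · rintro ⟨i, hi⟩
    exact ⟨_, ⟨i, rfl⟩, hi⟩
  · rintro ⟨_, ⟨i, rfl⟩, hi⟩
    exact ⟨i, hi⟩

lemma measurableSet_noisy [Countable ι] {n : ℕ} {B : ι → Set E} (hB : ∀ i, MeasurableSet (B i))
    {e : E × ℝ → ℝ} (he : Measurable e) (σ t : ℝ) : MeasurableSet (noisy n B e σ t) := by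
  rw [noisy_eq]
  refine MeasurableSet.iUnion fun T => ?_
  have hfst : Measurable fun z : Fin n → E × ℝ => fun j => (z j).1 := by fun_prop
  have hm : Measurable fun z : Fin n → E × ℝ => |∑ j ∈ T, e (z j)| :=
    (Finset.measurable_sum _ fun j _ => he.comp (measurable_pi_apply j)).abs
  exact (hfst (measurableSet_mem_traces hB T)).inter (measurableSet_lt measurable_const hm)

lemma CondSubG.measure_noisy_le [Countable ι] {n G : ℕ} {P : Measure (E × ℝ)} [IsProbabilityMeasure P]
    {B : ι → Set E} (hB : ∀ i, MeasurableSet (B i))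
    (hG : ∀ x : Fin n → E, (traces B x).card ≤ G)
    {e : E × ℝ → ℝ} (he : Measurable e) {σ : ℝ} (h : CondSubG P e σ) {t : ℝ} (ht : 0 ≤ t) :
    (Measure.pi fun _ : Fin n => P).real (noisy n B e σ t) ≤ 2 * (G * Real.exp (-t)) := by
  classical
  set μ := Measure.pi fun _ : Fin n => P
  have hfst : Measurable fun z : Fin n → E × ℝ => fun j => (z j).1 := by fun_prop
  have hT : ∀ T : Finset (Fin n), μ {z | (fun j => (z j).1) ∈ {x : Fin n → E | T ∈ traces B x} ∧
        Real.sqrt (2 * σ ^ 2 * t * T.card) < |∑ j ∈ T, e (z j)|}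
      ≤ 2 * ENNReal.ofReal (Real.exp (-t)) * μ {z | T ∈ traces B fun j => (z j).1} := by
    intro T
    have hA := measurableSet_mem_traces hB T
    have h1 := h.measure_lt_sum_le he ht hA T
    have h2 := h.neg.measure_lt_sum_le (by fun_prop) ht hA T
    have h3 : 2 * ENNReal.ofReal (Real.exp (-t)) * μ {z | T ∈ traces B fun j => (z j).1}
        = ENNReal.ofReal (Real.exp (-t)) * μ {z | T ∈ traces B fun j => (z j).1}
          + ENNReal.ofReal (Real.exp (-t)) * μ {z | T ∈ traces B fun j => (z j).1} := by ring
    rw [h3]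
    refine le_trans ((measure_mono ?_).trans (measure_union_le _ _)) (add_le_add h1 h2)
    rintro z ⟨hz, hz'⟩
    rcases lt_abs.1 hz' with hz' | hz'
    · exact Or.inl ⟨hz, hz'⟩
    · exact Or.inr ⟨hz, by simpa using hz'⟩
  -- The sum of these probabilities is the expected number of traces. Hence the union bound costs
  -- `G` and not `2 ^ n`, although the set of traces is random.
  have hsum : ∑ T : Finset (Fin n), μ {z | T ∈ traces B fun j => (z j).1} ≤ G := by
    have hm : ∀ T : Finset (Fin n),
        MeasurableSet {z : Fin n → E × ℝ | T ∈ traces B fun j => (z j).1} :=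
      fun T => hfst (measurableSet_mem_traces hB T)
    simp_rw [← fun T => lintegral_indicator_one (μ := μ) (hm T)]
    rw [← lintegral_finsetSum _ fun T _ => measurable_one.indicator (hm T)]
    calc _ ≤ ∫⁻ _z, (G : ENNReal) ∂μ := by
          refine lintegral_mono fun z => ?_
          simp only [Set.indicator_apply, Set.mem_ofPred_eq, Pi.one_apply, Finset.sum_boole]
          refine Nat.cast_le.2 (le_trans (le_of_eq ?_) (hG fun j => (z j).1))
          congr 1
          ext T
          simp
      _ = G := by simp
  have hfin : μ (noisy n B e σ t) ≤ 2 * ENNReal.ofReal (Real.exp (-t)) * G := by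
    rw [noisy_eq]
    refine (measure_iUnion_fintype_le _ _).trans ((Finset.sum_le_sum fun T _ => hT T).trans ?_)
    rw [← Finset.mul_sum]
    gcongr
  have h3 := ENNReal.toReal_mono (by finiteness) hfin
  rw [ENNReal.toReal_mul, ENNReal.toReal_mul, ENNReal.toReal_ofReal (Real.exp_pos _).le,
    ENNReal.toReal_ofNat, ENNReal.toReal_natCast] at h3
  rw [Measure.real]
  linarith

end Noise

/-! ### Bias and variance on a fixed sample -/

section Deterministic

variable {d n : ℕ}

lemma knnRadius_nonneg (k : ℕ) (D : Fin n → Cov d × ℝ) (x : Cov d) : 0 ≤ knnRadius k D x :=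
  Real.sInf_nonneg fun _ h => h.1.le

lemma knnRadius_le {k : ℕ} {D : Fin n → Cov d × ℝ} {x : Cov d} {τ : ℝ} (hτ : 0 < τ)
    (h : (k : ℝ) ≤ countIn D (Metric.closedBall x τ)) : knnRadius k D x ≤ τ :=
  csInf_le ⟨0, fun _ h => h.1.le⟩ ⟨hτ, h⟩

/-- The infimum is attained, since a slightly larger ball catches no further sample point. The
witness `τ` excludes the infimum of the empty set, whose default value is `0`. -/
lemma le_card_hits_knnMap {k : ℕ} {D : Fin n → Cov d × ℝ} {x : Cov d} {τ : ℝ} (hτ : 0 < τ)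
    (h : (k : ℝ) ≤ countIn D (Metric.closedBall x τ)) :
    k ≤ (hits (knnMap k D x) fun j => (D j).1).card := by
  obtain ⟨η, hη, hη'⟩ := exists_hits_closedBall_eq (fun j => (D j).1) x (knnRadius k D x)
  obtain ⟨r, ⟨-, hr⟩, hr'⟩ := exists_lt_of_csInf_lt
    (s := {τ : ℝ | 0 < τ ∧ (k : ℝ) ≤ countIn D (Metric.closedBall x τ)}) ⟨τ, hτ, h⟩
    (show sInf _ < knnRadius k D x + η from lt_add_of_pos_right _ hη)
  rw [countIn_eq_card_hits, Nat.cast_le] at hr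
  refine hr.trans (Finset.card_le_card fun j hj => ?_)
  rw [mem_hits] at hj ⊢
  exact hη' j (Metric.closedBall_subset_closedBall hr'.le hj)

/-- The local Lipschitz constant is attained. -/
lemma abs_sub_le_localLip {g : Cov d → ℝ} {V : Set (Cov d)} {L : NNReal}
    (hL : LipschitzOnWith L g V) {x y : Cov d} (hx : x ∈ V) (hy : y ∈ V) :
    |g x - g y| ≤ localLip g V * ‖x - y‖ := by
  have hLip : (L : ℝ) ∈ {M : ℝ | 0 ≤ M ∧ ∀ x ∈ V, ∀ y ∈ V, |g x - g y| ≤ M * ‖x - y‖} := by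
    refine ⟨L.2, fun x hx y hy => ?_⟩
    have := hL.dist_le_mul x hx y hy
    rwa [Real.dist_eq, dist_eq_norm] at this
  rcases (norm_nonneg (x - y)).eq_or_lt with h0 | h0
  · have := hLip.2 x hx y hy
    rw [← h0, mul_zero] at this ⊢
    exact this
  · rw [← div_le_iff₀ h0]
    refine le_csInf ⟨_, hLip⟩ fun M hM => ?_
    rw [div_le_iff₀ h0]
    exact hM.2 x hx y hy

lemma localLip_nonneg (g : Cov d → ℝ) (V : Set (Cov d)) : 0 ≤ localLip g V :=
  Real.sInf_nonneg fun _ h => h.1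

lemma localLip_le {g : Cov d → ℝ} {V : Set (Cov d)} {L : NNReal}
    (hL : LipschitzOnWith L g V) : localLip g V ≤ L := by
  refine csInf_le ⟨0, fun _ h => h.1⟩ ⟨L.2, fun x hx y hy => ?_⟩
  have := hL.dist_le_mul x hx y hy
  rwa [Real.dist_eq, dist_eq_norm] at this

/-- The bias–variance bound for the nearest-neighbour estimator on a given sample. -/
lemma abs_knnEstimator_sub_le {k : ℕ} (hk : 0 < k) {D : Fin n → Cov d × ℝ} {S : Set (Cov d)}
    (hD : ∀ j, (D j).1 ∈ S) {g : Cov d → ℝ} {L : NNReal} (hL : LipschitzOnWith L g S)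
    {x : Cov d} (hx : x ∈ S) {τ : ℝ} (hτ : 0 < τ)
    (hτk : (k : ℝ) ≤ countIn D (Metric.closedBall x τ)) {v : ℝ} (hv : 0 ≤ v)
    (hnoise : |∑ j ∈ hits (knnMap k D x) (fun j => (D j).1), ((D j).2 - g (D j).1)|
      ≤ Real.sqrt (v * (hits (knnMap k D x) fun j => (D j).1).card)) :
    |knnEstimator k D x - g x| ≤ Real.sqrt (v / k) + τ * localLip g (knnMap k D x ∩ S) := by
  classical
  set H := hits (knnMap k D x) fun j => (D j).1
  set M := localLip g (knnMap k D x ∩ S)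
  have hkH : k ≤ H.card := le_card_hits_knnMap hτ hτk
  have hkH' : (k : ℝ) ≤ H.card := by exact_mod_cast hkH
  have hk' : (0 : ℝ) < k := by exact_mod_cast hk
  have hH : (0 : ℝ) < H.card := hk'.trans_le hkH'
  have hM : 0 ≤ M := localLip_nonneg _ _
  have hest : knnEstimator k D x = (∑ j ∈ H, (D j).2) / H.card := by
    rw [knnEstimator, localEstimator, countIn_eq_card_hits]
    congr 1
    simp only [H, hits, Finset.sum_filter, Set.indicator_apply]
  have hdec : knnEstimator k D x - g x = (∑ j ∈ H, ((D j).2 - g (D j).1)) / H.card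
      + (∑ j ∈ H, (g (D j).1 - g x)) / H.card := by
    rw [hest, ← add_div, ← Finset.sum_add_distrib]
    simp only [sub_add_sub_cancel, Finset.sum_sub_distrib, Finset.sum_const, nsmul_eq_mul]
    field_simp
  have hxV : x ∈ knnMap k D x := Metric.mem_closedBall_self (knnRadius_nonneg k D x)
  have hbias : |∑ j ∈ H, (g (D j).1 - g x)| ≤ H.card * (τ * M) := by
    refine (Finset.abs_sum_le_sum_abs _ _).trans ?_
    rw [← nsmul_eq_mul]
    refine Finset.sum_le_card_nsmul _ _ _ fun j hj => ?_
    have hj' : (D j).1 ∈ knnMap k D x :=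
      mem_hits (z := fun j => (D j).1) |>.1 hj
    refine (abs_sub_le_localLip (hL.mono Set.inter_subset_right) ⟨hj', hD j⟩ ⟨hxV, hx⟩).trans ?_
    rw [mul_comm τ]
    refine mul_le_mul_of_nonneg_left ?_ hM
    exact (mem_closedBall_iff_norm.1 hj').trans (knnRadius_le hτ hτk)
  rw [hdec]
  refine (abs_add_le _ _).trans (add_le_add ?_ ?_)
  · rw [abs_div, abs_of_pos hH, div_le_iff₀ hH]
    refine hnoise.trans ?_
    -- A ball with more than `k` points, as with ties, only helps: `1 / H.card ≤ 1 / k`.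
    have : v * H.card ≤ v / k * H.card ^ 2 := by
      rw [div_mul_eq_mul_div, le_div_iff₀ hk', pow_two, mul_assoc]
      gcongr
    calc Real.sqrt (v * H.card) ≤ Real.sqrt (v / k * H.card ^ 2) := Real.sqrt_le_sqrt this
      _ = Real.sqrt (v / k) * H.card := by
        rw [Real.sqrt_mul (by positivity), Real.sqrt_sq hH.le]
  · rw [abs_div, abs_of_pos hH, div_le_iff₀ hH, mul_comm _ (H.card : ℝ)]
    exact hbias

end Deterministic

/-! ### The good event and the finite-sample bound -/

section Probability

variable {d : ℕ}

/-- Letting the radius increase to `τ` includes the endpoint `τ = T₀`, which `2k ≤ T₀^d n ℓ(x)`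
allows. -/
lemma BallMass.mass_le {P : Measure (Cov d × ℝ)} [IsProbabilityMeasure P] {S : Set (Cov d)}
    {ℓ : Cov d → ℝ} {T₀ : ℝ} (h : BallMass P S ℓ T₀) {x : Cov d} (hx : x ∈ S) {τ : ℝ}
    (hτ : 0 < τ) (hτT : τ ≤ T₀) : ℓ x * τ ^ d ≤ P.fst.real (Metric.closedBall x τ) := by
  have hlim : Filter.Tendsto (fun s : ℝ => ℓ x * s ^ d) (nhdsWithin τ (Set.Iio τ))
      (nhds (ℓ x * τ ^ d)) :=
    ((continuous_const.mul (continuous_pow d)).tendsto τ).mono_left nhdsWithin_le_nhds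
  refine le_of_tendsto hlim ?_
  filter_upwards [Ioo_mem_nhdsLT hτ] with s hs
  exact (h.mass x hx s hs.1 (hs.2.trans_le hτT)).trans
    (measureReal_mono (Metric.closedBall_subset_closedBall hs.2.le))

/-- The conditional bound is integrated over events of the covariate. An almost sure version `e` of
the noise is allowed because `g` itself need not be measurable off `S`. -/
lemma CondSubGaussianNoise.condSubG {P : Measure (Cov d × ℝ)} [IsProbabilityMeasure P]
    {g : Cov d → ℝ} {σ : ℝ} (h : CondSubGaussianNoise P g σ) {e : Cov d × ℝ → ℝ}
    (he : e =ᵐ[P] fun p => p.2 - g p.1) : CondSubG P e σ := by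
  intro l A hA
  have hm : sigmaX d ≤ (inferInstance : MeasurableSpace (Cov d × ℝ)) :=
    measurable_fst.comap_le
  have hsA : MeasurableSet[sigmaX d] (Prod.fst ⁻¹' A : Set (Cov d × ℝ)) := ⟨A, hA, rfl⟩
  have hint := h.integrable_exp l
  have h1 : ∫⁻ p in Prod.fst ⁻¹' A, ENNReal.ofReal (Real.exp (l * e p)) ∂P
      = ∫⁻ p in Prod.fst ⁻¹' A, ENNReal.ofReal (Real.exp (l * (p.2 - g p.1))) ∂P := by
    refine lintegral_congr_ae (ae_restrict_of_ae ?_)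
    filter_upwards [he] with p hp
    rw [hp]
  rw [h1, ← ofReal_integral_eq_lintegral_ofReal hint.integrableOn
    (Filter.Eventually.of_forall fun _ => (Real.exp_pos _).le),
    ← setIntegral_condExp hm hint hsA, ← ofReal_measureReal,
    ← ENNReal.ofReal_mul (Real.exp_pos _).le]
  refine ENNReal.ofReal_le_ofReal ?_
  calc _ ≤ ∫ _ in Prod.fst ⁻¹' A, Real.exp (l ^ 2 * σ ^ 2 / 2) ∂P :=
        setIntegral_mono_ae integrable_condExp.integrableOn
          (integrable_const _).integrableOn (h.condExp_exp_le l)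
    _ = _ := by rw [setIntegral_const, smul_eq_mul, mul_comm]

lemma one_lt_pow_div {d n : ℕ} {δ : ℝ} (hδ : 0 < δ) (hδ' : δ < 1 / 3) :
    3 < ((n : ℝ) + 1) ^ (d + 1) / δ := by
  rw [lt_div_iff₀ hδ]
  have : (1 : ℝ) ≤ ((n : ℝ) + 1) ^ (d + 1) := one_le_pow₀ (by linarith [n.cast_nonneg (α := ℝ)])
  linarith

lemma one_le_logTerm {d n : ℕ} {δ : ℝ} (hδ : 0 < δ) (hδ' : δ < 1 / 3) : 1 ≤ logTerm d n δ := by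
  have h := one_lt_pow_div (d := d) (n := n) hδ hδ'
  rw [logTerm, Real.le_log_iff_exp_le (by linarith)]
  linarith [Real.exp_one_lt_d9]

lemma IsIIDSample.map_eq {Ω : Type u} [MeasurableSpace Ω] {μ : Measure Ω}
    [IsProbabilityMeasure μ] {P : Measure (Cov d × ℝ)} {n : ℕ} {D : Fin n → Ω → Cov d × ℝ}
    (h : IsIIDSample μ P D) :
    μ.map (fun ω i => D i ω) = Measure.pi fun _ : Fin n => P := by
  rw [(iIndepFun_iff_map_fun_eq_pi_map fun i => (h.measurable i).aemeasurable).1 h.indep]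
  simp_rw [h.law]

lemma IsIIDSample.holdsWithProb {Ω : Type u} [MeasurableSpace Ω] {μ : Measure Ω}
    [IsProbabilityMeasure μ] {P : Measure (Cov d × ℝ)} {n : ℕ} {D : Fin n → Ω → Cov d × ℝ}
    (h : IsIIDSample μ P D) {p : ℝ} {Q : (Fin n → Cov d × ℝ) → Prop}
    (hQ : HoldsWithProb (Measure.pi fun _ : Fin n => P) p Q) {R : Ω → Prop}
    (hQR : ∀ ω, Q (fun i => D i ω) → R ω) : HoldsWithProb μ p R := by
  obtain ⟨A, hA, hpA, hAQ⟩ := hQ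
  have hD : Measurable fun ω i => D i ω := measurable_pi_iff.2 h.measurable
  refine ⟨_, hD hA, ?_, fun ω hω => hQR ω (hAQ _ hω)⟩
  rw [← h.map_eq] at hpA
  rwa [map_measureReal_apply hD hA] at hpA

/-- With high probability the noise averages out over all balls, all balls of mass at least
`2 k / n` hold `k` points, and all covariates lie in `S`. -/
lemma holdsWithProb_good {δ : ℝ} (hd : 1 ≤ d) (hδ : 0 < δ) (hδ' : δ < 1 / 3)
    {P : Measure (Cov d × ℝ)} [IsProbabilityMeasure P] {S : Set (Cov d)}
    (hS : ∀ᵐ x ∂P.fst, x ∈ S) {e : Cov d × ℝ → ℝ} (he : Measurable e) {σ : ℝ}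
    (hE : CondSubG P e σ) {n k : ℕ} (hn : 1 ≤ n)
    (hk : 8 * Real.log (4 * (2 * (n : ℝ) + 1) ^ (d + 1) / δ) ≤ k) :
    37 ≤ (k : ℝ) ∧ HoldsWithProb (Measure.pi fun _ : Fin n => P) (1 - 3 * δ) fun z =>
      z ∉ noisy n (rationalBall d) e σ (logTerm d n δ) ∧
      (fun j => (z j).1) ∉ underfilled P.fst n (rationalBall d) k ∧ ∀ j, (z j).1 ∈ S := by
  set t := logTerm d n δ
  have hn' : (1 : ℝ) ≤ n := by exact_mod_cast hn
  have hpow : (9 : ℝ) ≤ (2 * (n : ℝ) + 1) ^ (d + 1) :=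
    calc (9 : ℝ) = 3 ^ 2 := by norm_num
      _ ≤ 3 ^ (d + 1) := pow_le_pow_right₀ (by norm_num) (by omega)
      _ ≤ _ := by gcongr; linarith
  have hbig : (108 : ℝ) ≤ 4 * (2 * (n : ℝ) + 1) ^ (d + 1) / δ := by
    rw [le_div_iff₀ hδ]
    linarith
  have hk37 : 37 ≤ (k : ℝ) := by
    -- As `d ≥ 1`, `n ≥ 1` and `δ < 1/3`, the argument of the logarithm is at least `4 * 9 * 3 =
    -- 108`, and `8 log 108 > 37`. This supplies the threshold `74 = 2 * 37` of the binomial lower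
    -- tail.
    have h1 : (37 / 8 : ℝ) ≤ Real.log 108 := by
      rw [Real.le_log_iff_exp_le (by norm_num)]
      refine le_of_pow_le_pow_left₀ (n := 8) (by norm_num) (by norm_num) ?_
      have h0 : Real.exp (37 / 8) ^ 8 = Real.exp 1 ^ 37 := by
        rw [← Real.exp_nat_mul, ← Real.exp_nat_mul]
        norm_num
      rw [h0]
      refine (pow_le_pow_left₀ (Real.exp_pos 1).le Real.exp_one_lt_d9.le 37).trans ?_
      norm_num
    have h2 := Real.log_le_log (by norm_num) hbig
    linarith
  refine ⟨hk37, ?_⟩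
  set π := Measure.pi fun _ : Fin n => P
  have hB : ∀ i, MeasurableSet (rationalBall d i) := measurableSet_rationalBall
  -- `S` need not be measurable, so its complement is enlarged to a measurable null set.
  obtain ⟨U, hSU, hU, hU0⟩ := exists_measurable_superset_of_null (show P.fst Sᶜ = 0 from hS)
  have hfst : MeasurePreserving (fun z : Fin n → Cov d × ℝ => fun j => (z j).1) π
      (Measure.pi fun _ => P.fst) :=
    measurePreserving_pi _ _ fun _ => ⟨measurable_fst, rfl⟩
  have hN := measurableSet_noisy (n := n) hB he σ t
  have hF := hfst.measurable (measurableSet_underfilled P.fst (n := n) hB k)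
  have hV : MeasurableSet {z : Fin n → Cov d × ℝ | ∃ j, (z j).1 ∈ U} := by
    rw [Set.ofPred_exists]
    exact MeasurableSet.iUnion fun j => (measurable_pi_apply j).fst hU
  have hN' : π.real (noisy n (rationalBall d) e σ t) ≤ 2 * δ := by
    refine (hE.measure_noisy_le hB (fun x => card_traces_rationalBall_le x) he
      (zero_le_one.trans (one_le_logTerm hδ hδ'))).trans (le_of_eq ?_)
    have hpos : (0 : ℝ) < ((n : ℝ) + 1) ^ (d + 1) := by positivity
    rw [logTerm, Real.exp_neg, Real.exp_log (by positivity), Fintype.card_fin]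
    push_cast
    field_simp
  have hF' : π.real ((fun z : Fin n → Cov d × ℝ => fun j => (z j).1) ⁻¹'
      underfilled P.fst n (rationalBall d) k) ≤ δ := by
    rw [hfst.measureReal_preimage (measurableSet_underfilled P.fst hB k).nullMeasurableSet]
    refine (measure_underfilled_le P.fst hB hk37
      (fun w => card_traces_rationalBall_le w)).trans ?_
    have h1 : Real.exp (-k / 8) ≤ δ / (4 * (2 * (n : ℝ) + 1) ^ (d + 1)) := by
      rw [← inv_div (4 * (2 * (n : ℝ) + 1) ^ (d + 1)) δ,
        ← Real.exp_log (show 0 < 4 * (2 * (n : ℝ) + 1) ^ (d + 1) / δ by positivity),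
        ← Real.exp_neg]
      exact Real.exp_le_exp.2 (by linarith)
    rw [le_div_iff₀ (by positivity)] at h1
    simp only [Fintype.card_sum, Fintype.card_fin]
    push_cast
    rw [← two_mul]
    linarith
  have hV' : π.real {z : Fin n → Cov d × ℝ | ∃ j, (z j).1 ∈ U} = 0 := by
    rw [measureReal_eq_zero_iff, Set.ofPred_exists]
    refine measure_iUnion_null fun j => ?_
    have h1 := (measurePreserving_eval (fun _ : Fin n => P) j).measure_preimage
      (measurable_fst hU).nullMeasurableSet
    rw [← Measure.fst_apply hU, hU0] at h1
    exact h1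
  set bad := noisy n (rationalBall d) e σ t ∪
    ((fun z : Fin n → Cov d × ℝ => fun j => (z j).1) ⁻¹'
      underfilled P.fst n (rationalBall d) k ∪ {z | ∃ j, (z j).1 ∈ U})
  have hbad : MeasurableSet bad := hN.union (hF.union hV)
  refine ⟨badᶜ, hbad.compl, ?_, ?_⟩
  · rw [probReal_compl_eq_one_sub hbad]
    have h1 := measureReal_union_le (μ := π) (noisy n (rationalBall d) e σ t)
      ((fun z : Fin n → Cov d × ℝ => fun j => (z j).1) ⁻¹'
      underfilled P.fst n (rationalBall d) k ∪ {z | ∃ j, (z j).1 ∈ U})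
    have h2 := measureReal_union_le (μ := π)
      ((fun z : Fin n → Cov d × ℝ => fun j => (z j).1) ⁻¹'
      underfilled P.fst n (rationalBall d) k) {z | ∃ j, (z j).1 ∈ U}
    linarith
  · intro z hz
    simp only [bad, Set.mem_compl_iff, Set.mem_union, not_or] at hz
    refine ⟨hz.1, hz.2.1, fun j => ?_⟩
    by_contra hj
    exact hz.2.2 ⟨j, hSU hj⟩

/-- The finite-sample bound, under the product law. -/
lemma holdsWithProb_abs_knnEstimator_sub_le (hd : 1 ≤ d) {δ : ℝ} (hδ : 0 < δ) (hδ' : δ < 1 / 3)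
    {P : Measure (Cov d × ℝ)} [IsProbabilityMeasure P] {S : Set (Cov d)}
    (hS : ∀ᵐ x ∂P.fst, x ∈ S) {g : Cov d → ℝ} {σ : ℝ} (hE : CondSubGaussianNoise P g σ)
    {L : NNReal} (hL : LipschitzOnWith L g S) {ℓ : Cov d → ℝ} {T₀ : ℝ}
    (hX : BallMass P S ℓ T₀) {n k : ℕ} (hn : 1 ≤ n)
    (hk : 8 * Real.log (4 * (2 * (n : ℝ) + 1) ^ (d + 1) / δ) ≤ k) :
    HoldsWithProb (Measure.pi fun _ : Fin n => P) (1 - 3 * δ) fun D =>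
      ∀ x ∈ S, 2 * (k : ℝ) ≤ T₀ ^ d * n * ℓ x →
        |knnEstimator k D x - g x| ≤ Real.sqrt (2 * σ ^ 2 * logTerm d n δ / k) +
          (2 * (k : ℝ) / (n * ℓ x)) ^ (1 / (d : ℝ)) * localLip g (knnMap k D x ∩ S) := by
  -- A Lipschitz extension to the whole space makes the noise a measurable function, and it agrees
  -- with `g` at every covariate in `S`.
  obtain ⟨g', hg', hgg'⟩ := hL.extend_real
  set e : Cov d × ℝ → ℝ := fun p => p.2 - g' p.1
  have he : Measurable e := measurable_snd.sub (hg'.continuous.measurable.comp measurable_fst)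
  have hSP : ∀ᵐ p ∂P, p.1 ∈ S := ae_of_ae_map measurable_fst.aemeasurable hS
  have hee : e =ᵐ[P] fun p => p.2 - g p.1 := by
    filter_upwards [hSP] with p hp
    simp only [e, hgg' hp]
  obtain ⟨hk37, A, hA, hpA, hAQ⟩ := holdsWithProb_good hd hδ hδ' hS he (hE.condSubG hee) hn hk
  refine ⟨A, hA, hpA, fun D hDA x hx hkx => ?_⟩
  obtain ⟨h1, h2, h3⟩ := hAQ D hDA
  have hn0 : (0 : ℝ) < n := by exact_mod_cast hn
  have hk0 : (0 : ℝ) < k := by linarith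
  have hℓ := hX.pos x hx
  have hd0 : d ≠ 0 := by omega
  set τ : ℝ := (2 * (k : ℝ) / (n * ℓ x)) ^ (1 / (d : ℝ))
  have hτ0 : 0 < τ := by positivity
  have hτd : τ ^ d = 2 * k / (n * ℓ x) := by
    simp only [τ, one_div]
    exact Real.rpow_inv_natCast_pow (by positivity) hd0
  have hτT : τ ≤ T₀ := by
    refine le_of_pow_le_pow_left₀ hd0 hX.radius_pos.le ?_
    rw [hτd, div_le_iff₀ (by positivity)]
    linarith
  have hmass := hX.mass_le hx hτ0 hτT
  have hcount : (k : ℝ) ≤ countIn D (Metric.closedBall x τ) := by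
    obtain ⟨i, hi, hi'⟩ := exists_rationalBall (fun j => (D j).1) x hτ0.le
    rw [countIn_eq_card_hits, ← hi']
    by_contra! hcon
    refine h2 ⟨i, ?_, hcon⟩
    have h4 := hmass.trans (measureReal_mono hi)
    rw [hτd] at h4
    calc 2 * (k : ℝ) = n * (ℓ x * (2 * k / (n * ℓ x))) := by field_simp
      _ ≤ _ := by gcongr
  have ht := one_le_logTerm (d := d) (n := n) hδ hδ'
  refine abs_knnEstimator_sub_le (by exact_mod_cast hk0) h3 hL hx hτ0 hcount
    (v := 2 * σ ^ 2 * logTerm d n δ) (by positivity) ?_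
  -- The nearest-neighbour ball depends on the sample, but it has the trace of some rational ball,
  -- and the noise is controlled on all of these at once.
  obtain ⟨i, -, hi⟩ := exists_rationalBall (fun j => (D j).1) x (knnRadius_nonneg k D x)
  have h5 : ∑ j ∈ hits (knnMap k D x) (fun j => (D j).1), ((D j).2 - g (D j).1)
      = ∑ j ∈ hits (knnMap k D x) (fun j => (D j).1), e (D j) :=
    Finset.sum_congr rfl fun j _ => by simp only [e, hgg' (h3 j)]
  rw [h5, knnMap, ← hi]
  by_contra! hcon
  exact h1 ⟨i, hcon⟩

end Probability

/-! ### The order of `k` and the rate -/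

section Rates

lemma eventually_log_le {d : ℕ} {δ : ℝ} (hδ : 0 < δ) {s c : ℝ} (hs : 0 < s) (hc : 0 < c) :
    ∀ᶠ n : ℕ in Filter.atTop,
      Real.log (4 * (2 * (n : ℝ) + 1) ^ (d + 1) / δ) ≤ c * (n : ℝ) ^ s := by
  have h1 : (fun x : ℝ => Real.log (4 / δ) + (d + 1) * Real.log 3 + (d + 1) * Real.log x)
      =o[Filter.atTop] fun x : ℝ => x ^ s :=
    ((Asymptotics.isLittleO_const_left.2 (Or.inr (tendsto_norm_atTop_atTop.comp
      (tendsto_rpow_atTop hs))))).add ((isLittleO_log_rpow_atTop hs).const_mul_left _)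
  have h2 := tendsto_natCast_atTop_atTop.eventually (h1.bound hc)
  filter_upwards [h2, Filter.eventually_ge_atTop 1] with n hn hn1
  have hn1' : (1 : ℝ) ≤ n := by exact_mod_cast hn1
  rw [Real.norm_of_nonneg (Real.rpow_nonneg (Nat.cast_nonneg n) s)] at hn
  refine le_trans ?_ ((le_abs_self _).trans hn)
  have h3 : 4 * (2 * (n : ℝ) + 1) ^ (d + 1) / δ = 4 / δ * (2 * (n : ℝ) + 1) ^ (d + 1) := by ring
  rw [h3, Real.log_mul (by positivity) (by positivity), Real.log_pow]
  have h4 : Real.log (2 * (n : ℝ) + 1) ≤ Real.log 3 + Real.log n := by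
    rw [← Real.log_mul (by norm_num) (by positivity)]
    exact Real.log_le_log (by positivity) (by linarith)
  push_cast
  nlinarith [(d.cast_nonneg : (0 : ℝ) ≤ d)]

lemma logTerm_le {d n : ℕ} {δ : ℝ} (hδ : 0 < δ) :
    logTerm d n δ ≤ Real.log (4 * (2 * (n : ℝ) + 1) ^ (d + 1) / δ) := by
  refine Real.log_le_log (by positivity) ?_
  gcongr
  have h : ((n : ℝ) + 1) ^ (d + 1) ≤ (2 * (n : ℝ) + 1) ^ (d + 1) := by
    gcongr
    linarith [n.cast_nonneg (α := ℝ)]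
  have : (0 : ℝ) ≤ (2 * (n : ℝ) + 1) ^ (d + 1) := by positivity
  linarith

/-- The rate of convergence `(log ((n+1)^(d+1)/δ) / n)^(1/(d+2))`. -/
noncomputable def knnRate (d n : ℕ) (δ : ℝ) : ℝ :=
  (logTerm d n δ / n) ^ (1 / ((d : ℝ) + 2))

variable {d n : ℕ} {δ : ℝ}

lemma knnRate_pos (hδ : 0 < δ) (hδ' : δ < 1 / 3) (hn : 1 ≤ n) : 0 < knnRate d n δ := by
  have ht := one_le_logTerm (d := d) (n := n) hδ hδ'
  have hn' : (0 : ℝ) < n := by exact_mod_cast hn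
  exact Real.rpow_pos_of_pos (by positivity) _

lemma knnRate_pow (hδ : 0 < δ) (hδ' : δ < 1 / 3) :
    knnRate d n δ ^ (d + 2) = logTerm d n δ / n := by
  have ht := one_le_logTerm (d := d) (n := n) hδ hδ'
  have := Real.rpow_inv_natCast_pow (x := logTerm d n δ / n) (n := d + 2) (by positivity)
    (by omega)
  rw [knnRate, one_div]
  exact_mod_cast this

/-- The optimal order of `k` is `n` times the `d`-th power of the rate. -/
lemma rpow_mul_logTerm_rpow (hδ : 0 < δ) (hδ' : δ < 1 / 3) (hn : 1 ≤ n) :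
    (n : ℝ) ^ (2 / ((d : ℝ) + 2)) * logTerm d n δ ^ ((d : ℝ) / ((d : ℝ) + 2))
      = n * knnRate d n δ ^ d := by
  have ht := one_le_logTerm (d := d) (n := n) hδ hδ'
  have hn' : (0 : ℝ) < n := by exact_mod_cast hn
  rw [knnRate, ← Real.rpow_mul_natCast (by positivity), one_div_mul_eq_div,
    Real.div_rpow (by positivity) hn'.le]
  have h : (2 : ℝ) / (d + 2) = 1 - d / (d + 2) := by
    field_simp
    ring
  rw [h, Real.rpow_sub hn', Real.rpow_one]
  ring

/-- As `logTerm ≥ 1`, the order condition forces `k ≥ n^(2/(d+2)) / a₂`, which outgrows any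
logarithm. -/
lemma eventually_isOptimalOrder_ge (hδ : 0 < δ) (hδ' : δ < 1 / 3) {a₁ a₂ : ℝ} (ha₂ : 1 ≤ a₂) :
    ∀ᶠ n : ℕ in Filter.atTop, ∀ k : ℕ, IsOptimalOrder d n k δ a₁ a₂ →
      8 * Real.log (4 * (2 * (n : ℝ) + 1) ^ (d + 1) / δ) ≤ k := by
  filter_upwards [eventually_log_le (d := d) hδ (show (0 : ℝ) < 2 / ((d : ℝ) + 2) by positivity)
    (show 0 < 1 / (8 * a₂) by positivity)] with n hn k hk
  have ht := one_le_logTerm (d := d) (n := n) hδ hδ'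
  have h1 : (n : ℝ) ^ (2 / ((d : ℝ) + 2)) ≤ a₂ * k :=
    (le_mul_of_one_le_right (by positivity) (Real.one_le_rpow ht (by positivity))).trans hk.2
  rw [one_div_mul_eq_div, le_div_iff₀ (by positivity)] at hn
  refine le_of_mul_le_mul_left ?_ (show 0 < a₂ by linarith)
  linarith

lemma eventually_isOptimalOrder_le (hd : 1 ≤ d) (hδ : 0 < δ) (hδ' : δ < 1 / 3) {a₁ a₂ : ℝ}
    (ha₁ : 0 < a₁) {β : ℝ} (hβ : 0 < β) :
    ∀ᶠ n : ℕ in Filter.atTop, ∀ k : ℕ, IsOptimalOrder d n k δ a₁ a₂ → 2 * (k : ℝ) ≤ β * n := by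
  -- The cap at `1` gives `γ ^ d ≤ γ`, so a rate below `γ` has its `d`-th power below `β * a₁ / 2`.
  set γ : ℝ := min 1 (β * a₁ / 2)
  have hγ : 0 < γ := by positivity
  filter_upwards [eventually_log_le (d := d) hδ one_pos (show 0 < γ ^ (d + 2) by positivity),
    Filter.eventually_ge_atTop 1] with n hn hn1 k hk
  have hn' : (0 : ℝ) < n := by exact_mod_cast hn1
  have h1 : knnRate d n δ ≤ γ := by
    refine le_of_pow_le_pow_left₀ (n := d + 2) (by omega) hγ.le ?_
    rw [knnRate_pow hδ hδ', div_le_iff₀ hn']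
    rw [Real.rpow_one] at hn
    exact (logTerm_le hδ).trans hn
  have h2 : knnRate d n δ ^ d ≤ β * a₁ / 2 :=
    calc knnRate d n δ ^ d ≤ γ ^ d :=
          pow_le_pow_left₀ (knnRate_pos hδ hδ' hn1).le h1 d
      _ ≤ γ := pow_le_of_le_one hγ.le (min_le_left _ _) (by omega)
      _ ≤ _ := min_le_right _ _
  have h3 := hk.1
  rw [rpow_mul_logTerm_rpow hδ hδ' hn1] at h3
  have h4 : (n : ℝ) * knnRate d n δ ^ d ≤ n * (β * a₁ / 2) := by gcongr
  refine le_of_mul_le_mul_left ?_ ha₁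
  linarith

/-- For `k` of the optimal order the finite-sample bound is of the order of the rate. -/
lemma IsOptimalOrder.bound_le (hd : 1 ≤ d) (hδ : 0 < δ) (hδ' : δ < 1 / 3) (hn : 1 ≤ n) {k : ℕ}
    {a₁ a₂ : ℝ} (ha₁ : 0 < a₁) (ha₁' : a₁ ≤ 1) (ha₂ : 1 ≤ a₂)
    (h : IsOptimalOrder d n k δ a₁ a₂) (σ : ℝ) {l M : ℝ} (hl : 0 < l) (hM : 0 ≤ M) :
    Real.sqrt (2 * σ ^ 2 * logTerm d n δ / k) + (2 * (k : ℝ) / (n * l)) ^ (1 / (d : ℝ)) * M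
      ≤ Real.sqrt a₂ / a₁ * (Real.sqrt (2 * σ ^ 2) + 2 * M * (2 / l) ^ (1 / (d : ℝ)))
        * (logTerm d n δ / n) ^ (1 / ((d : ℝ) + 2)) := by
  change _ ≤ _ * knnRate d n δ
  have hn' : (0 : ℝ) < n := by exact_mod_cast hn
  have hρ := knnRate_pos (d := d) hδ hδ' hn
  have hpow := knnRate_pow (d := d) (n := n) hδ hδ'
  obtain ⟨h1, h2⟩ := h
  rw [rpow_mul_logTerm_rpow hδ hδ' hn] at h1 h2
  set ρ := knnRate d n δ
  have hk : (0 : ℝ) < k := by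
    by_contra! hk
    have : 0 < n * ρ ^ d := by positivity
    nlinarith
  have ht : logTerm d n δ = n * ρ ^ d * ρ ^ 2 := by
    rw [mul_assoc, ← pow_add, hpow]
    field_simp
  have hsq : 1 ≤ Real.sqrt a₂ := Real.one_le_sqrt.2 ha₂
  have hsq' : Real.sqrt a₂ ≤ Real.sqrt a₂ / a₁ := le_div_self (by positivity) ha₁ ha₁'
  have hvar : Real.sqrt (2 * σ ^ 2 * logTerm d n δ / k)
      ≤ Real.sqrt a₂ / a₁ * Real.sqrt (2 * σ ^ 2) * ρ := by
    have h3 : 2 * σ ^ 2 * logTerm d n δ / k ≤ a₂ * (2 * σ ^ 2) * ρ ^ 2 := by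
      rw [div_le_iff₀ hk, ht]
      calc 2 * σ ^ 2 * (n * ρ ^ d * ρ ^ 2) ≤ 2 * σ ^ 2 * (a₂ * k * ρ ^ 2) := by gcongr
        _ = _ := by ring
    refine (Real.sqrt_le_sqrt h3).trans ?_
    rw [Real.sqrt_mul (by positivity), Real.sqrt_mul (by positivity), Real.sqrt_sq hρ.le]
    gcongr
  have hbias : (2 * (k : ℝ) / (n * l)) ^ (1 / (d : ℝ)) ≤ (2 / l) ^ (1 / (d : ℝ)) * (ρ / a₁) := by
    have h3 : 2 * (k : ℝ) / (n * l) ≤ 2 / l * (ρ / a₁) ^ d := by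
      -- Replacing `a₁` by the smaller `a₁ ^ d` makes the `d`-th root exact and produces the factor
      -- `1 / a₁`.
      have h4 : a₁ ^ d ≤ a₁ := pow_le_of_le_one ha₁.le ha₁' (by omega)
      have h5 : a₁ ^ d * k ≤ n * ρ ^ d := (mul_le_mul_of_nonneg_right h4 hk.le).trans h1
      rw [div_pow, div_mul_div_comm, div_le_div_iff₀ (by positivity) (by positivity)]
      have h6 := mul_le_mul_of_nonneg_left h5 (show 0 ≤ 2 * l by positivity)
      linarith
    refine (Real.rpow_le_rpow (by positivity) h3 (by positivity)).trans (le_of_eq ?_)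
    rw [Real.mul_rpow (by positivity) (by positivity), one_div,
      Real.pow_rpow_inv_natCast (by positivity) (by omega)]
  have hq : 0 ≤ (2 / l) ^ (1 / (d : ℝ)) := by positivity
  have hbias' : (2 * (k : ℝ) / (n * l)) ^ (1 / (d : ℝ)) * M
      ≤ Real.sqrt a₂ / a₁ * (2 * M * (2 / l) ^ (1 / (d : ℝ))) * ρ := by
    have h3 : 0 ≤ M * (2 / l) ^ (1 / (d : ℝ)) * (ρ / a₁) := by positivity
    calc _ ≤ (2 / l) ^ (1 / (d : ℝ)) * (ρ / a₁) * M := by gcongr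
      _ = 1 * (M * (2 / l) ^ (1 / (d : ℝ)) * (ρ / a₁)) := by ring
      _ ≤ (2 * Real.sqrt a₂) * (M * (2 / l) ^ (1 / (d : ℝ)) * (ρ / a₁)) := by
        gcongr
        linarith
      _ = _ := by ring
  rw [mul_add, add_mul]
  exact add_le_add hvar hbias'

end Rates

/-! ### The three assertions -/

theorem mainTheorem5 (d : ℕ) (hd : 1 ≤ d) (δ : ℝ) (hδ : 0 < δ) (hδ' : δ < 1 / 3)
    (P : Measure (Cov d × ℝ)) [IsProbabilityMeasure P]
    (S : Set (Cov d)) (hS : ∀ᵐ x ∂P.fst, x ∈ S)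
    (g : Cov d → ℝ) (hg : IsRegressionFunction P g)
    (σ : ℝ) (hE : CondSubGaussianNoise P g σ)
    (L : NNReal) (hL : LipschitzOnWith L g S)
    (ℓ : Cov d → ℝ) (T₀ : ℝ) (hX : BallMass P S ℓ T₀) :
    -- the finite-sample bound
    (∀ n k : ℕ, 1 ≤ n →
      8 * Real.log (4 * (2 * (n : ℝ) + 1) ^ (d + 1) / δ) ≤ k →
      ∀ (Ω : Type u) [MeasurableSpace Ω] (μ : Measure Ω) [IsProbabilityMeasure μ]
        (D : Fin n → Ω → Cov d × ℝ), IsIIDSample μ P D →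
      HoldsWithProb μ (1 - 3 * δ) fun ω =>
        ∀ x ∈ S, 2 * (k : ℝ) ≤ T₀ ^ d * n * ℓ x →
          |knnEstimator k (fun i => D i ω) x - g x| ≤
            Real.sqrt (2 * σ ^ 2 * logTerm d n δ / k) +
              2 * (2 * (k : ℝ) / (n * ℓ x)) ^ (1 / (d : ℝ)) *
                localLip g (knnMap k (fun i => D i ω) x ∩ S)) ∧
    -- the pointwise rate; how large `n` has to be may depend on the point `x`
    (∀ a₁ a₂ : ℝ, 0 < a₁ → a₁ ≤ 1 → 1 ≤ a₂ →
      ∃ N : Cov d → ℕ, ∀ n k : ℕ, IsOptimalOrder d n k δ a₁ a₂ →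
        ∀ (Ω : Type u) [MeasurableSpace Ω] (μ : Measure Ω) [IsProbabilityMeasure μ]
          (D : Fin n → Ω → Cov d × ℝ), IsIIDSample μ P D →
        HoldsWithProb μ (1 - 3 * δ) fun ω =>
          ∀ x ∈ S, N x ≤ n →
            |knnEstimator k (fun i => D i ω) x - g x| ≤
              Real.sqrt a₂ / a₁ *
                (Real.sqrt (2 * σ ^ 2) +
                  2 * localLip g (knnMap k (fun i => D i ω) x ∩ S) *
                    (2 / ℓ x) ^ (1 / (d : ℝ))) *
                (logTerm d n δ / n) ^ (1 / ((d : ℝ) + 2))) ∧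
    -- the sup-norm rate
    (∀ b : ℝ, 0 < b → (∀ x ∈ S, b ≤ ℓ x) →
      ∀ a₁ a₂ : ℝ, 0 < a₁ → a₁ ≤ 1 → 1 ≤ a₂ →
      ∃ N : ℕ, ∀ n k : ℕ, N ≤ n → IsOptimalOrder d n k δ a₁ a₂ →
        ∀ (Ω : Type u) [MeasurableSpace Ω] (μ : Measure Ω) [IsProbabilityMeasure μ]
          (D : Fin n → Ω → Cov d × ℝ), IsIIDSample μ P D →
        HoldsWithProb μ (1 - 3 * δ) fun ω =>
          supDist S (knnEstimator k fun i => D i ω) g ≤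
            ENNReal.ofReal
              (Real.sqrt a₂ / a₁ *
                (Real.sqrt (2 * σ ^ 2) + 2 * L * (2 / b) ^ (1 / (d : ℝ))) *
                (logTerm d n δ / n) ^ (1 / ((d : ℝ) + 2)))) := by

  have key := fun {n k : ℕ} (hn : 1 ≤ n)
    (hk : 8 * Real.log (4 * (2 * (n : ℝ) + 1) ^ (d + 1) / δ) ≤ k) =>
    holdsWithProb_abs_knnEstimator_sub_le hd hδ hδ' hS hE hL hX hn hk
  have hlip : ∀ {n : ℕ} (k : ℕ) (D : Fin n → Cov d × ℝ) (x : Cov d),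
      0 ≤ localLip g (knnMap k D x ∩ S) := fun k D x => localLip_nonneg _ _
  refine ⟨?_, ?_, ?_⟩
  · intro n k hn hk Ω _ μ _ D hD
    refine hD.holdsWithProb (key hn hk) fun ω h x hx hkx => (h x hx hkx).trans ?_
    have hℓ := hX.pos x hx
    -- The bias was bounded without the factor `2`, so nonnegativity suffices.
    have : 0 ≤ (2 * (k : ℝ) / (n * ℓ x)) ^ (1 / (d : ℝ)) := by positivity
    have := mul_nonneg this (hlip k (fun i => D i ω) x)
    linarith
  · intro a₁ a₂ ha₁ ha₁' ha₂
    have hN : ∀ x : Cov d, ∃ N : ℕ, x ∈ S → ∀ n, N ≤ n → ∀ k : ℕ,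
        IsOptimalOrder d n k δ a₁ a₂ → 2 * (k : ℝ) ≤ T₀ ^ d * n * ℓ x := by
      intro x
      by_cases hx : x ∈ S
      · have hβ : 0 < T₀ ^ d * ℓ x := mul_pos (pow_pos hX.radius_pos d) (hX.pos x hx)
        obtain ⟨N, hN⟩ := Filter.eventually_atTop.1
          (eventually_isOptimalOrder_le (a₂ := a₂) hd hδ hδ' ha₁ hβ)
        exact ⟨N, fun _ n hn k hk => (hN n hn k hk).trans (le_of_eq (by ring))⟩
      · exact ⟨0, fun h => absurd h hx⟩
    choose N hN using hN
    obtain ⟨N₀, hN₀⟩ := Filter.eventually_atTop.1 ((Filter.eventually_ge_atTop 1).and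
      (eventually_isOptimalOrder_ge (d := d) (a₁ := a₁) hδ hδ' ha₂))
    refine ⟨fun x => max N₀ (N x), fun n k hnk Ω _ μ _ D hD => ?_⟩
    by_cases hn : N₀ ≤ n
    · obtain ⟨hn1, hk⟩ := hN₀ n hn
      refine hD.holdsWithProb (key hn1 (hk k hnk)) fun ω h x hx hNx => ?_
      exact (h x hx (hN x hx n ((le_max_right _ _).trans hNx) k hnk)).trans
        (hnk.bound_le hd hδ hδ' hn1 ha₁ ha₁' ha₂ σ (hX.pos x hx) (hlip k _ x))
    -- For `n < N₀` no point satisfies `N x ≤ n`, and the assertion is empty.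
    · refine ⟨Set.univ, MeasurableSet.univ, ?_, fun ω _ x _ hNx =>
        absurd ((le_max_left _ _).trans hNx) hn⟩
      rw [probReal_univ]
      linarith
  · intro b hb hbℓ a₁ a₂ ha₁ ha₁' ha₂
    have hβ : 0 < T₀ ^ d * b := mul_pos (pow_pos hX.radius_pos d) hb
    obtain ⟨N, hN⟩ := Filter.eventually_atTop.1 ((Filter.eventually_ge_atTop 1).and
      ((eventually_isOptimalOrder_ge (d := d) (a₁ := a₁) hδ hδ' ha₂).and
        (eventually_isOptimalOrder_le (a₂ := a₂) hd hδ hδ' ha₁ hβ)))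
    refine ⟨N, fun n k hn hnk Ω _ μ _ D hD => ?_⟩
    obtain ⟨hn1, hk, hk'⟩ := hN n hn
    refine hD.holdsWithProb (key hn1 (hk k hnk)) fun ω h => ?_
    refine iSup₂_le fun x hx => ENNReal.ofReal_le_ofReal ?_
    have hℓ := hX.pos x hx
    have hbx := hbℓ x hx
    have hn0 : (0 : ℝ) < n := by exact_mod_cast hn1
    have hkx : 2 * (k : ℝ) ≤ T₀ ^ d * n * ℓ x := by
      refine (hk' k hnk).trans ?_
      have := pow_pos hX.radius_pos d
      calc T₀ ^ d * b * n ≤ T₀ ^ d * ℓ x * n := by gcongr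
        _ = _ := by ring
    -- The finite-sample bound decreases in `ℓ x` and increases in the local Lipschitz constant, so
    -- `b` and `L` may replace them.
    refine (h x hx hkx).trans (le_trans ?_
      (hnk.bound_le hd hδ hδ' hn1 ha₁ ha₁' ha₂ σ hb L.2))
    have hL' := localLip_le (hL.mono (Set.inter_subset_right (s := knnMap k (fun i => D i ω) x)))
    have := hlip k (fun i => D i ω) x
    gcongr
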